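/- **Model.** A streaming algorithm keeps, between consecutive stream events, a string of bits (its memory). To process an event, or to answer a query, it draws a fresh uniformly random integer from a finite range $\{0,\dots,N\}$, with $N$ determined by its parameters, its memory and the event, and computes the new memory (respectively a nonnegative rational answer) from these data. It is one procedure that receives four integer parameters: $m$, the window parameter, $\lceil 1/\varepsilon\rceil$ and $\lceil 1/\delta\rceil$. For a finite list $W$ of elements of $[m]=\{1,\dots,m\}$ let $F_k(W)=\sum_{i=1}^m x_i^k$, where $x_i$ is the number of occurrences of $i$ in $W$. In the *sequence-based* model the events are arrivals of elements of $[m]$, and the window $W$ consists of the last $n$ arrived elements (of all of them, if fewer than $n$ have arrived), where $n\ge 1$ is fixed in advance. In the *timestamp-based* model the events are arrivals of elements of $[m]$ and advances of an integer clock by one unit; the timestamp $T(p)$ of an element is the clock value at its arrival, and the window $W$ at clock value $t$ consists of the arrived elements with $t-T(p)<t_0$, where $t_0\ge 1$ is fixed in advance. **Statement.** Let $k>2$ be a real number. In each of the two sliding-window models there are a streaming algorithm and constants $C,c$ depending only on $k$ such that the following holds for all $m\ge 1$, all window parameters ($n\ge1$, respectively $t_0\ge1$), all $\varepsilon,\delta\in(0,1)$,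 and after every finite sequence of events: 1. (accuracy) the answer $Y$ of the algorithm satisfies $\Pr\big[\,|Y-F_k(W)|\le \varepsilon F_k(W)\,\big]\ge 1-\delta$, where $W$ is the current window; 2. (worst-case memory) for every outcome of the random choices, the number of bits stored is at most $$C\,\varepsilon^{-2}\,\log(2/\delta)\; m^{1-1/k}\,L^{c},$$ where $L=\log(2+mn)$ in the sequence-based model and $L=\log(2+m\,t_0\,|W|)$ in the timestamp-based model. In particular the memory is $\tilde O(m^{1-1/k})$ bits for fixed $\varepsilon,\delta$. Moreover, if $k$ is a computable real number (for example an integer or a rational), the algorithm is effective: all its rules are computable functions of the parameters, the memory, the event and the random integer. -/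

import Mathlib

/-- A randomized one-pass streaming algorithm reading stream events of type `α`.
It is a single procedure serving all choices of its four integer parameters.
The memory kept between two consecutive events is a string of bits.  To process an event, and to
answer a query, the algorithm draws one fresh uniformly random integer from `{0, …, N}`, where `N`
is determined by the parameters, the memory content and the event (several simultaneous draws are a
single draw from a larger range), and acts deterministically on it.
An answer `(a, b)` stands for the nonnegative rational number `a / (b + 1)`. -/
structure StreamAlgorithm (α : Type) where
  init : ℕ × ℕ × ℕ × ℕ → List Bool
  updateRange : ℕ × ℕ × ℕ × ℕ → List Bool → α → ℕ
  update : ℕ × ℕ × ℕ × ℕ → List Bool → α → ℕ → List Bool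
  queryRange : ℕ × ℕ × ℕ × ℕ → List Bool → ℕ
  query : ℕ × ℕ × ℕ × ℕ → List Bool → ℕ → ℕ × ℕ

namespace StreamAlgorithm

variable {α : Type}

/-- The random memory content after processing one event. -/
noncomputable def step (A : StreamAlgorithm α) (p : ℕ × ℕ × ℕ × ℕ) (s : List Bool) (e : α) :
    PMF (List Bool) :=
  (PMF.uniformOfFintype (Fin (A.updateRange p s e + 1))).map (fun r => A.update p s e r)

/-- The law of the memory content after the events of the list (in chronological order). -/
noncomputable def stateLaw (A : StreamAlgorithm α) (p : ℕ × ℕ × ℕ × ℕ) (stream : List α) :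
    PMF (List Bool) :=
  stream.foldl (fun μ e => μ.bind (fun s => A.step p s e)) (PMF.pure (A.init p))

/-- The law of the answer to a query asked right after the events of the list. -/
noncomputable def answerLaw (A : StreamAlgorithm α) (p : ℕ × ℕ × ℕ × ℕ) (stream : List α) :
    PMF ℝ :=
  (A.stateLaw p stream).bind (fun s =>
    (PMF.uniformOfFintype (Fin (A.queryRange p s + 1))).map
      (fun r => ((A.query p s r).1 : ℝ) / ((A.query p s r).2 + 1)))

/-- All five components are computable functions, uniformly in the parameters. -/
def Effective [Primcodable α] (A : StreamAlgorithm α) : Prop :=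
  Computable A.init ∧
  Computable (fun x : (ℕ × ℕ × ℕ × ℕ) × List Bool × α => A.updateRange x.1 x.2.1 x.2.2) ∧
  Computable (fun x : (ℕ × ℕ × ℕ × ℕ) × List Bool × α × ℕ =>
    A.update x.1 x.2.1 x.2.2.1 x.2.2.2) ∧
  Computable (fun x : (ℕ × ℕ × ℕ × ℕ) × List Bool => A.queryRange x.1 x.2) ∧
  Computable (fun x : (ℕ × ℕ × ℕ × ℕ) × List Bool × ℕ => A.query x.1 x.2.1 x.2.2)

/-- Worst-case memory: after the given events the algorithm never (for no outcome of its random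
draws) stores more than `B` bits. -/
def MemoryAtMost (A : StreamAlgorithm α) (p : ℕ × ℕ × ℕ × ℕ) (stream : List α) (B : ℝ) : Prop :=
  ∀ s ∈ (A.stateLaw p stream).support, (s.length : ℝ) ≤ B

/-- After the given events the answer is within relative error `ε` of `F`, except with probability
at most `δ`. -/
def Approximates (A : StreamAlgorithm α) (p : ℕ × ℕ × ℕ × ℕ) (stream : List α)
    (ε δ F : ℝ) : Prop :=
  ENNReal.ofReal (1 - δ) ≤ (A.answerLaw p stream).toOuterMeasure {y | |y - F| ≤ ε * F}

end StreamAlgorithm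

/-- A (nonnegative) real number is computable if dyadic approximations of it, to any prescribed
accuracy, can be computed. -/
def IsComputableReal (x : ℝ) : Prop :=
  ∃ f : ℕ → ℕ, Computable f ∧ ∀ i : ℕ, |x - (f i : ℝ) / 2 ^ i| ≤ 1 / 2 ^ i

/-- The `k`-th frequency moment of a list of elements of `{1, …, m}`. -/
noncomputable def freqMoment (k : ℝ) (m : ℕ) (w : List ℕ) : ℝ :=
  ∑ i ∈ Finset.Icc 1 m, (w.count i : ℝ) ^ k

/-- Sequence-based window of size `n`: the last `n` elements (all of them, if fewer arrived). -/
def seqWindow (n : ℕ) (stream : List ℕ) : List ℕ :=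
  stream.drop (stream.length - n)

/-- Timestamp-based window with parameter `t₀`.  The event `none` advances the clock by one time
unit, the event `some x` is the arrival of the element `x`, whose timestamp is the current clock
value.  The age `t - T(x)` of an element is thus the number of clock advances after its arrival,
and the element is active if its age is less than `t₀`. -/
def timeWindow (t₀ : ℕ) : List (Option ℕ) → List ℕ
  | [] => []
  | none :: l => timeWindow t₀ l
  | some x :: l => if l.count none < t₀ then x :: timeWindow t₀ l else timeWindow t₀ l

/-! One copy of the algorithm estimates `F_k` from samples. Let r be the number of occurrences of a
window element from its own position to the end. Then the sum of `r^k - (r-1)^k` over all positions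
of the window telescopes, for each value separately, to `F_k`. A uniformly chosen position together
with its r therefore yields an unbiased estimate, except that neither the length nor the left end of
a sliding window can be stored exactly.

The arrivals are cut into consecutive buckets, each holding its exact size and one of its positions,
uniformly sampled. The estimate is the sum over buckets of size times `φ(sample)`, with φ vanishing
on expired samples. When two buckets merge, a sample survives with probability proportional to the
size of its bucket, so the expected estimate is unchanged (`sum_weight_mergeBuckets`). A bucket is
dropped only when its newest element expires, and then its sample has expired as well
(`weight_tick`). Hence the straddling oldest bucket causes no bias: its expired positions simply
contribute 0 (`expect_weight`, `arrivalSum_eq_rankSum`).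

A merged bucket may be at most one larger than the total of the newer buckets. So the buckets cover
at most twice the window (`Good.total_le`), and Cauchy-Schwarz bounds the second moment by `2|W|`
times the sum of `φ²`. Together with `|W| ≤ m^(1-1/k) F_k^(1/k)` this is `O(k m^(1-1/k) F_k²)`
(`length_mul_rankSum_sq_le`). Conversely, if no pair can be merged, the total doubles with every two
buckets. One merge per arrival suffices to keep the number of buckets logarithmic
(`Sparse.mergeNewest`), for every outcome of the draws, so the memory bound is worst-case.

Independent copies are summed in groups of order `m^(1-1/k)/ε²`. Chebyshev's inequality bounds the
failure of a group by 1/15, and the median of `O(log(2/δ))` groups fails with probability at most δ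
(`median_concentration`). The sequence model is the timestamp model with a clock tick before every
arrival (`copyLaw_seq`). For effectiveness, scaled real powers are replaced by integers found by an
exhaustive search for an integer certificate (`powerCert`); the rounding error is absorbed in ε. -/

open scoped ENNReal

/-- A sampled element, its age, and its number of occurrences from the sampled position on. -/
abbrev Sample := ℕ × ℕ × ℕ

/-- A block of consecutive arrivals: its size, the age of its newest element, and a sample. -/
abbrev Bucket := ℕ × ℕ × Sample

/-! ### Bucket lists and the merging rule. -/

namespace WindowSketch

/-- Effect of a clock tick on a sample; expired samples become `(0, t, 0)`. -/
def ageSample (t : ℕ) (x : Sample) : Sample :=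
  if x.2.1 + 1 < t then (x.1, x.2.1 + 1, x.2.2) else (0, t, 0)

/-- Effect of the arrival of `e` on a sample. -/
def hitSample (e : ℕ) (x : Sample) : Sample :=
  if x.1 = e then (x.1, x.2.1, x.2.2 + 1) else x

/-- Effect of a clock tick on a bucket list (oldest bucket first). -/
def tick (t : ℕ) (l : List Bucket) : List Bucket :=
  l.filterMap fun b =>
    if b.2.1 + 1 < t then some (b.1, b.2.1 + 1, ageSample t b.2.2) else none

/-- Total number of elements covered by the buckets. -/
def total (l : List Bucket) : ℕ := (l.map Prod.fst).sum

/-- The buckets before merging, after the arrival of `e`. -/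
def insertNew (e : ℕ) (l : List Bucket) : List Bucket :=
  l.map (fun b => (b.1, b.2.1, hitSample e b.2.2)) ++ [(1, 0, e, 0, 1)]

/-- Union of two adjacent buckets, where `u` decides which sample survives. -/
def mergeBuckets (u : ℕ) (b b' : Bucket) : Bucket :=
  (b.1 + b'.1, b'.2.1, if u < b.1 then b.2.2 else b'.2.2)

/-- Size of the union of the two first buckets, if they may be merged, and `0` otherwise. -/
def headRange (b : Bucket) (l : List Bucket) : ℕ :=
  match l with
  | [] => 0
  | b' :: l' => if b.1 + b'.1 ≤ total l' + 1 then b.1 + b'.1 else 0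

/-- Size of the newest mergeable pair of adjacent buckets (`0` if there is none). -/
def mergeRange : List Bucket → ℕ
  | [] => 0
  | b :: l => if mergeRange l = 0 then headRange b l else mergeRange l

/-- Merge the first two buckets, if this is allowed. -/
def headMerge (u : ℕ) (b : Bucket) (l : List Bucket) : List Bucket :=
  match l with
  | [] => [b]
  | b' :: l' => if b.1 + b'.1 ≤ total l' + 1 then mergeBuckets u b b' :: l' else b :: b' :: l'

/-- Merge the newest mergeable pair of adjacent buckets. -/
def mergeNewest (u : ℕ) : List Bucket → List Bucket
  | [] => []
  | b :: l => if mergeRange l = 0 then headMerge u b l else b :: mergeNewest u l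

/-- The linear statistic `∑ size * φ(sample)`. -/
def weight (φ : Sample → ℕ) (l : List Bucket) : ℕ := (l.map fun b => b.1 * φ b.2.2).sum

@[simp] lemma total_nil : total [] = 0 := rfl
@[simp] lemma total_cons (b : Bucket) (l : List Bucket) : total (b :: l) = b.1 + total l := by
  simp [total]
@[simp] lemma total_append (l l' : List Bucket) : total (l ++ l') = total l + total l' := by
  simp [total]
@[simp] lemma weight_nil (φ : Sample → ℕ) : weight φ [] = 0 := rfl
@[simp] lemma weight_cons (φ : Sample → ℕ) (b : Bucket) (l : List Bucket) :
    weight φ (b :: l) = b.1 * φ b.2.2 + weight φ l := by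
  simp [weight]

/-- The sample of a bucket is expired, or records at most `c a` occurrences at age `a`. -/
def SampleOK (t m : ℕ) (c : ℕ → ℕ) (b : Bucket) : Prop :=
  b.2.1 ≤ b.2.2.2.1 ∧
    ((b.2.2.2.1 < t ∧ b.2.2.1 ≤ m ∧ b.2.2.2.2 ≤ c b.2.2.2.1) ∨ b.2.2 = (0, t, 0))

/-- Invariant of the bucket list; `c a` is the number of arrived elements of age at most `a`. -/
def Good (t m : ℕ) (c : ℕ → ℕ) : List Bucket → Prop
  | [] => True
  | b :: l => 1 ≤ b.1 ∧ b.1 ≤ total l + 1 ∧ total l < c b.2.1 ∧ b.2.1 < t ∧ SampleOK t m c b ∧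
      (∀ b' ∈ l, b'.2.1 ≤ b.2.1) ∧ Good t m c l

/-- The sizes grow geometrically. -/
def Sparse : List Bucket → Prop
  | [] => True
  | _ :: l => 2 ^ (l.length / 2) ≤ total l + 1 ∧ Sparse l

/-! ### Preservation of the invariants. -/

variable {t m : ℕ} {c c' : ℕ → ℕ}

/-- If the two oldest buckets cannot be merged, their sizes add up to more than `total l + 1` for
the newer part `l`, so adding them at least doubles `total + 1`. -/
lemma two_pow_length_le_of_mergeRange_eq_zero : ∀ l : List Bucket, Good t m c l →
    mergeRange l = 0 → 2 ^ (l.length / 2) ≤ total l + 1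
  | [], _, _ => by simp
  | [b], _, _ => by simp
  | b :: b' :: l, h, h0 => by
    have h2 : mergeRange (b' :: l) = 0 := by
      by_contra hne
      rw [mergeRange, if_neg hne] at h0
      exact hne h0
    have h3 : mergeRange l = 0 := by
      by_contra hne
      rw [mergeRange, if_neg hne] at h2
      exact hne h2
    rw [mergeRange, if_pos h2] at h0
    have ih := two_pow_length_le_of_mergeRange_eq_zero l h.2.2.2.2.2.2.2.2.2.2.2.2 h3
    have hb := h.1
    have : total l + 1 < b.1 + b'.1 := by
      by_contra hle
      rw [headRange, if_pos (by omega)] at h0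
      omega
    have e : (b :: b' :: l).length / 2 = l.length / 2 + 1 := by simp; omega
    rw [e, pow_succ]
    simp only [total_cons]
    omega

lemma sparse_of_mergeRange_eq_zero : ∀ l : List Bucket, Good t m c l →
    mergeRange l = 0 → Sparse l
  | [], _, _ => trivial
  | b :: l, h, h0 => by
    have h2 : mergeRange l = 0 := by
      by_contra hne
      rw [mergeRange, if_neg hne] at h0
      exact hne h0
    exact ⟨two_pow_length_le_of_mergeRange_eq_zero l h.2.2.2.2.2.2 h2,
      sparse_of_mergeRange_eq_zero l h.2.2.2.2.2.2 h2⟩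

lemma headMerge_spec (u : ℕ) (b : Bucket) (l : List Bucket) :
    total (headMerge u b l) = b.1 + total l ∧
      (headRange b l ≠ 0 → (headMerge u b l).length = l.length) ∧
      (∀ a, (∀ b' ∈ b :: l, b'.2.1 ≤ a) → ∀ b' ∈ headMerge u b l, b'.2.1 ≤ a) := by
  cases l with
  | nil => simp [headMerge, headRange]
  | cons b' l =>
    by_cases h : b.1 + b'.1 ≤ total l + 1
    · simp [headMerge, headRange, h, mergeBuckets]
      omega
    · simp [headMerge, headRange, h]

lemma mergeNewest_spec (u : ℕ) (l : List Bucket) :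
    total (mergeNewest u l) = total l ∧
      (mergeRange l ≠ 0 → (mergeNewest u l).length + 1 = l.length) ∧
      (∀ a, (∀ b' ∈ l, b'.2.1 ≤ a) → ∀ b' ∈ mergeNewest u l, b'.2.1 ≤ a) := by
  induction l with
  | nil => simp [mergeNewest, mergeRange]
  | cons b l ih =>
    by_cases h : mergeRange l = 0
    · obtain ⟨h1, h2, h3⟩ := headMerge_spec u b l
      simp only [mergeNewest, mergeRange, if_pos h, List.length_cons]
      exact ⟨by simp [h1], fun hne => by rw [h2 hne], h3⟩
    · obtain ⟨h1, h2, h3⟩ := ih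
      simp only [mergeNewest, mergeRange, if_neg h, List.length_cons]
      refine ⟨by simp [h1], fun hne => by rw [h2 hne], fun a ha b' hb' => ?_⟩
      rcases List.mem_cons.1 hb' with rfl | hb'
      · exact ha _ (by simp)
      · exact h3 a (fun x hx => ha x (by simp [hx])) b' hb'

/-- The permission to merge is exactly the size bound required of the merged bucket. Its age is that
of the newer bucket; an inherited older sample is at least as old, because ages do not increase
along the list. -/
lemma Good.mergeNewest (u : ℕ) : ∀ l : List Bucket, Good t m c l → Good t m c (mergeNewest u l)
  | [], _ => trivial
  | b :: l, h => by
    by_cases h0 : mergeRange l = 0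
    · rw [WindowSketch.mergeNewest, if_pos h0]
      cases l with
      | nil => exact h
      | cons b' l =>
        by_cases hle : b.1 + b'.1 ≤ total l + 1
        · rw [headMerge, if_pos hle]
          obtain ⟨h1, h2, h3, h4, h5, h6, h1', h2', h3', h4', h5', h6', h7⟩ := h
          refine ⟨by simp only [mergeBuckets]; omega, hle, h3', h4', ?_, h6', h7⟩
          unfold mergeBuckets
          split_ifs
          · exact ⟨(h6 b' (by simp)).trans h5.1, h5.2⟩
          · exact h5'
        · rw [headMerge, if_neg hle]; exact h
    · rw [WindowSketch.mergeNewest, if_neg h0]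
      obtain ⟨h1, h2, h3, h4, h5, h6, h7⟩ := h
      obtain ⟨e1, e2, e3⟩ := mergeNewest_spec u l
      exact ⟨h1, by rw [e1]; exact h2, by rw [e1]; exact h3, h4, h5, e3 _ h6, h7.mergeNewest u⟩

/-- Consider the part of the list newer than a given bucket. If a merge takes place inside it, its
length returns to the value before the arrival while its total does not decrease, so the old bound
persists. If none is possible inside it, that part satisfies the bound by itself. Thus a single
merge per arrival is enough. -/
lemma Sparse.mergeNewest (u : ℕ) (n : Bucket) (hn : 1 ≤ n.1) : ∀ l : List Bucket,
    Good t m c (l ++ [n]) → Sparse l → Sparse (mergeNewest u (l ++ [n]))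
  | [], _, _ => by simp [WindowSketch.mergeNewest, mergeRange, headMerge, Sparse]
  | b :: l, h, hs => by
    rw [List.cons_append] at h ⊢
    by_cases h0 : mergeRange (l ++ [n]) = 0
    · rw [WindowSketch.mergeNewest, if_pos h0]
      have hg := h.2.2.2.2.2.2
      have hs := sparse_of_mergeRange_eq_zero _ hg h0
      have hp := two_pow_length_le_of_mergeRange_eq_zero _ hg h0
      generalize l ++ [n] = L at *
      cases L with
      | nil => exact ⟨by simp, trivial⟩
      | cons b' L =>
        by_cases hle : b.1 + b'.1 ≤ total L + 1
        · rw [headMerge, if_pos hle]; exact hs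
        · rw [headMerge, if_neg hle]; exact ⟨hp, hs⟩
    · rw [WindowSketch.mergeNewest, if_neg h0]
      obtain ⟨e1, e2, e3⟩ := mergeNewest_spec u (l ++ [n])
      have := e2 h0
      refine ⟨?_, Sparse.mergeNewest u n hn l h.2.2.2.2.2.2 hs.2⟩
      have e : (WindowSketch.mergeNewest u (l ++ [n])).length = l.length := by simpa using this
      rw [e, e1]
      have := hs.1
      simp
      omega

lemma Good.insertNew {e : ℕ} (he : e ≤ m) (ht : 1 ≤ t) (he0 : 1 ≤ e) (hc : ∀ a, c' a = c a + 1) :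
    ∀ l : List Bucket, Good t m c l → Good t m c' (insertNew e l)
  | [], _ => by
    simp [WindowSketch.insertNew, Good, SampleOK, hc]
    omega
  | b :: l, h => by
    obtain ⟨h1, h2, h3, h4, h5, h6, h7⟩ := h
    have ih := Good.insertNew he ht he0 hc l h7
    have et : total (WindowSketch.insertNew e l) = total l + 1 := by
      simp [WindowSketch.insertNew, total, Function.comp_def]
    refine ⟨h1, ?_, ?_, h4, ?_, ?_, ih⟩
    · change b.1 ≤ total (WindowSketch.insertNew e l) + 1
      omega
    · change total (WindowSketch.insertNew e l) < c' b.2.1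
      rw [et, hc]; omega
    · obtain ⟨s1, s2 | s2⟩ := h5
      · change SampleOK t m c' (b.1, b.2.1, hitSample e b.2.2)
        unfold hitSample
        split_ifs with hh
        · exact ⟨s1, Or.inl ⟨s2.1, s2.2.1, by rw [hc]; have := s2.2.2; simp; omega⟩⟩
        · exact ⟨s1, Or.inl ⟨s2.1, s2.2.1, by rw [hc]; have := s2.2.2; simp; omega⟩⟩
      · refine ⟨?_, Or.inr ?_⟩
        · simp only [hitSample]; split_ifs <;> exact s1
        · simp only [hitSample, s2]
          -- Arriving elements are at least 1, so an expired sample, marked by the element 0, is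
          -- never hit.
          rw [if_neg (by omega)]
    · intro b' hb'
      rcases List.mem_append.1 hb' with hb' | hb'
      · obtain ⟨x, hx, rfl⟩ := List.mem_map.1 hb'
        exact h6 x hx
      · rw [List.mem_singleton.1 hb']; exact Nat.zero_le _

lemma Sparse.map_hit {e : ℕ} : ∀ l : List Bucket, Sparse l →
    Sparse (l.map (fun b => ((b.1, b.2.1, hitSample e b.2.2) : Bucket)))
  | [], _ => trivial
  | b :: l, h => by
    refine ⟨?_, Sparse.map_hit l h.2⟩
    have := h.1
    simpa [total, Function.comp_def] using this

/-- The oldest bucket comes first and has the largest age; if it survives the tick, every bucket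
does. -/
lemma tick_cons_of_lt {b : Bucket} {l : List Bucket} (h : Good t m c (b :: l))
    (hb : b.2.1 + 1 < t) : tick t (b :: l) =
      (b :: l).map fun b => ((b.1, b.2.1 + 1, ageSample t b.2.2) : Bucket) := by
  unfold tick
  rw [← List.filterMap_eq_map]
  refine List.filterMap_congr fun x hx => ?_
  have : x.2.1 ≤ b.2.1 := by
    rcases List.mem_cons.1 hx with rfl | hx
    · exact le_rfl
    · exact h.2.2.2.2.2.1 x hx
  rw [if_pos (by omega)]
  rfl

lemma tick_cons_of_not_lt {b : Bucket} {l : List Bucket} (hb : ¬ b.2.1 + 1 < t) :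
    tick t (b :: l) = tick t l := by
  simp [tick, hb]

lemma Good.map_age (hc : ∀ a, c' (a + 1) = c a) : ∀ l : List Bucket, Good t m c l →
    (∀ b ∈ l, b.2.1 + 1 < t) →
    Good t m c' (l.map fun b => ((b.1, b.2.1 + 1, ageSample t b.2.2) : Bucket))
  | [], _, _ => trivial
  | b :: l, h, hl => by
    obtain ⟨h1, h2, h3, h4, h5, h6, h7⟩ := h
    have et : total (l.map fun b => ((b.1, b.2.1 + 1, ageSample t b.2.2) : Bucket)) = total l := by
      simp [total, Function.comp_def]
    refine ⟨h1, ?_, ?_, hl b (by simp), ?_, ?_, Good.map_age hc l h7 fun x hx => hl x (by simp [hx])⟩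
    · rw [et]; exact h2
    · rw [et, hc]; exact h3
    · have hbt := hl b (by simp)
      obtain ⟨s1, s2⟩ := h5
      change SampleOK t m c' (b.1, b.2.1 + 1, ageSample t b.2.2)
      unfold ageSample SampleOK
      split_ifs with hh
      · rcases s2 with s2 | s2
        · exact ⟨by simpa using s1, Or.inl ⟨hh, s2.2.1, by simpa [hc] using s2.2.2⟩⟩
        · rw [s2] at hh; simp at hh
      · exact ⟨by simp; omega, Or.inr rfl⟩
    · intro b' hb'
      obtain ⟨x, hx, rfl⟩ := List.mem_map.1 hb'
      simpa using h6 x hx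

lemma Sparse.map_age : ∀ l : List Bucket, Sparse l →
    Sparse (l.map fun b => ((b.1, b.2.1 + 1, ageSample t b.2.2) : Bucket))
  | [], _ => trivial
  | b :: l, h => by
    refine ⟨?_, Sparse.map_age l h.2⟩
    have := h.1
    simpa [total, Function.comp_def] using this

/-- A tick removes an initial segment of the list, and the invariant passes to tails. For the
survivors, age `a + 1` after the tick corresponds to age `a` before it. -/
lemma Good.tick (hc : ∀ a, c' (a + 1) = c a) : ∀ {l : List Bucket}, Good t m c l →
    Good t m c' (tick t l)
  | [], _ => trivial
  | b :: l, h => by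
    by_cases hb : b.2.1 + 1 < t
    · rw [tick_cons_of_lt h hb]
      refine Good.map_age hc _ h fun x hx => ?_
      rcases List.mem_cons.1 hx with rfl | hx
      · exact hb
      · have := h.2.2.2.2.2.1 x hx
        omega
    · rw [tick_cons_of_not_lt hb]
      exact Good.tick hc h.2.2.2.2.2.2

lemma Sparse.tick : ∀ {l : List Bucket}, Sparse l → Good t m c l → Sparse (tick t l)
  | [], _, _ => trivial
  | b :: l, hs, h => by
    by_cases hb : b.2.1 + 1 < t
    · rw [tick_cons_of_lt h hb]
      exact hs.map_age
    · rw [tick_cons_of_not_lt hb]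
      exact hs.2.tick h.2.2.2.2.2.2

lemma good_sparse_arrive {e : ℕ} (u : ℕ) (he : e ≤ m) (ht : 1 ≤ t) (he0 : 1 ≤ e)
    (hc : ∀ a, c' a = c a + 1) {l : List Bucket} (h : Good t m c l) (hs : Sparse l) :
    Good t m c' (mergeNewest u (insertNew e l)) ∧ Sparse (mergeNewest u (insertNew e l)) := by
  have hg := h.insertNew he ht he0 hc
  exact ⟨hg.mergeNewest u, Sparse.mergeNewest u _ le_rfl _ hg hs.map_hit⟩

/-! ### Conservation of the linear statistics in one step. -/

/-- A sample is at least as old as the newest element of its bucket. So the sample of a dropped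
bucket has expired, and `hφ` makes its term vanish. -/
lemma weight_tick {φ : Sample → ℕ} (hφ : φ (0, t, 0) = 0) : ∀ l : List Bucket, Good t m c l →
    weight φ (tick t l) = weight (fun x => φ (ageSample t x)) l
  | [], _ => rfl
  | b :: l, h => by
    by_cases hb : b.2.1 + 1 < t
    · rw [tick_cons_of_lt h hb]
      simp [weight, Function.comp_def]
    · rw [tick_cons_of_not_lt hb, weight_tick hφ l h.2.2.2.2.2.2, weight_cons]
      have : ageSample t b.2.2 = (0, t, 0) := by
        have := h.2.2.2.2.1.1
        rw [ageSample, if_neg (by omega)]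
      rw [this, hφ]; simp

lemma weight_insertNew (φ : Sample → ℕ) (e : ℕ) (l : List Bucket) :
    weight φ (insertNew e l) = weight (fun x => φ (hitSample e x)) l + φ (e, 0, 1) := by
  simp [weight, insertNew, Function.comp_def]

/-- Of the `b.1 + b'.1` equally likely draws, `b.1` keep the first sample and `b'.1` the second. The
new size cancels the denominator, leaving each old term with its old size as weight. -/
lemma sum_weight_mergeBuckets (φ : Sample → ℕ) (b b' : Bucket) (l : List Bucket) :
    ∑ u ∈ Finset.range (b.1 + b'.1), weight φ (mergeBuckets u b b' :: l) =
      (b.1 + b'.1) * weight φ (b :: b' :: l) := by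
  rw [Finset.sum_range_add]
  have h1 : ∀ u ∈ Finset.range b.1, weight φ (mergeBuckets u b b' :: l) =
      (b.1 + b'.1) * φ b.2.2 + weight φ l := by
    intro u hu
    simp [mergeBuckets, Finset.mem_range.1 hu]
  have h2 : ∀ u ∈ Finset.range b'.1, weight φ (mergeBuckets (b.1 + u) b b' :: l) =
      (b.1 + b'.1) * φ b'.2.2 + weight φ l := by
    intro u _
    simp [mergeBuckets]
  rw [Finset.sum_congr rfl h1, Finset.sum_congr rfl h2]
  simp
  ring

lemma sum_weight_mergeNewest (φ : Sample → ℕ) : ∀ l : List Bucket,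
    ∑ u ∈ Finset.range (mergeRange l - 1 + 1), weight φ (mergeNewest u l) =
      (mergeRange l - 1 + 1) * weight φ l
  | [] => by simp [mergeRange, mergeNewest]
  | b :: l => by
    by_cases h0 : mergeRange l = 0
    · simp only [mergeRange, mergeNewest, if_pos h0]
      cases l with
      | nil => simp [headRange, headMerge]
      | cons b' l =>
        by_cases hle : b.1 + b'.1 ≤ total l + 1
        · simp only [headRange, headMerge, if_pos hle]
          rcases Nat.eq_zero_or_pos (b.1 + b'.1) with h | h
          · have h1 : b.1 = 0 := by omega
            have h2 : b'.1 = 0 := by omega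
            simp [h1, h2, mergeBuckets]
          · rw [Nat.sub_add_cancel h, sum_weight_mergeBuckets]
        · simp [headRange, headMerge, if_neg hle]
    · simp only [mergeRange, mergeNewest, if_neg h0, weight_cons]
      rw [Finset.sum_add_distrib, sum_weight_mergeNewest φ l]
      simp
      ring

/-- Cauchy-Schwarz, with the bucket sizes as weights. -/
lemma weight_sq_le (φ : Sample → ℕ) : ∀ l : List Bucket,
    weight φ l ^ 2 ≤ total l * weight (fun x => φ x ^ 2) l
  | [] => by simp
  | b :: l => by
    have ih := weight_sq_le φ l
    simp only [weight_cons, total_cons]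
    set w := weight φ l
    set v := weight (fun x => φ x ^ 2) l
    -- The cross term: by the induction hypothesis and the inequality of the means, multiplied by
    -- `total l`. If `total l = 0`, the induction hypothesis forces `w = 0`.
    have key : 2 * (φ b.2.2 * w) ≤ total l * φ b.2.2 ^ 2 + v := by
      rcases Nat.eq_zero_or_pos (total l) with h | h
      · have hw : w = 0 := by
          rw [h, zero_mul] at ih
          exact pow_eq_zero_iff (two_ne_zero) |>.1 (Nat.le_zero.1 ih)
        simp [hw]
      · refine Nat.le_of_mul_le_mul_left ?_ h
        have := two_mul_le_add_sq (total l * φ b.2.2) w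
        nlinarith
    nlinarith [Nat.mul_le_mul_left b.1 key]

/-- All newer elements and the newest one of `b` have age at most that of `b`, and `b` is at most
one larger than the newer total. Hence the possibly expired part of `b` at most doubles the count.
-/
lemma Good.total_le {b : Bucket} {l : List Bucket} (h : Good t m c (b :: l)) :
    total (b :: l) ≤ 2 * c b.2.1 := by
  have := h.2.1
  have := h.2.2.1
  simp
  omega

end WindowSketch

namespace WindowSketch

/-! Self-delimiting binary code of bucket lists. -/

/-- Code of a number: its binary digits, each preceded by `true`, and an end mark. -/
def encodeNum (n : ℕ) : List Bool := n.bits.flatMap (fun b => [true, b]) ++ [false, true]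

/-- Code of a bucket list. -/
def encodeBuckets (l : List Bucket) : List Bool :=
  l.flatMap (fun b => encodeNum (Encodable.encode b)) ++ [false, false]

/-- Code of a list of bucket lists. -/
def encodeState (ss : List (List Bucket)) : List Bool := ss.flatMap encodeBuckets

/-- Decoding step; the symbols are read from right to left, in pairs. -/
def decodeStep (b : Bool) (st : List (List ℕ) × Option Bool) : List (List ℕ) × Option Bool :=
  match st.2 with
  | none => (st.1, some b)
  | some c =>
    (if b then st.1.modifyHead (List.modifyHead fun n => 2 * n + c.toNat)
      else if c then st.1.modifyHead (List.cons 0) else [] :: st.1, none)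

/-- The bucket with the given number. -/
def decodeBucket (n : ℕ) : Bucket := (Encodable.decode n : Option Bucket).getD default

/-- Inverse of `encodeState`. -/
def decodeState (s : List Bool) : List (List Bucket) :=
  (s.foldr decodeStep ([], none)).1.map (List.map decodeBucket)

lemma decodeBucket_encode (b : Bucket) : decodeBucket (Encodable.encode b) = b := by
  rw [decodeBucket, Encodable.encodek, Option.getD_some]

/-- `Nat.bits` puts the least significant digit first, so reading from the right is Horner's scheme.
-/
lemma foldr_decodeStep_bits (bs : List Bool) (n : ℕ) (l : List ℕ) (ls : List (List ℕ)) :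
    (bs.flatMap fun b => [true, b]).foldr decodeStep ((n :: l) :: ls, none) =
      ((bs.foldr (fun b a => 2 * a + b.toNat) n :: l) :: ls, none) := by
  induction bs with
  | nil => rfl
  | cons b bs ih => simp [ih, decodeStep]

lemma foldr_bits (n : ℕ) : n.bits.foldr (fun b a => 2 * a + b.toNat) 0 = n := by
  induction n using Nat.binaryRec' with
  | zero => simp
  | bit b n h ih =>
    rw [Nat.bits_append_bit _ _ h, List.foldr_cons, ih, Nat.bit_val]

lemma foldr_decodeStep_num (n : ℕ) (l : List ℕ) (ls : List (List ℕ)) :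
    (encodeNum n).foldr decodeStep (l :: ls, none) = ((n :: l) :: ls, none) := by
  have : [false, true].foldr decodeStep (l :: ls, none) = ((0 :: l) :: ls, none) := rfl
  rw [encodeNum, List.foldr_append, this, foldr_decodeStep_bits, foldr_bits]

lemma foldr_decodeStep_buckets (l : List Bucket) (ls : List (List ℕ)) :
    (encodeBuckets l).foldr decodeStep (ls, none) = (l.map Encodable.encode :: ls, none) := by
  have : [false, false].foldr decodeStep (ls, none) = ([] :: ls, none) := rfl
  rw [encodeBuckets, List.foldr_append, this]
  induction l with
  | nil => rfl
  | cons b l ih =>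
    rw [List.flatMap_cons, List.foldr_append, ih, foldr_decodeStep_num, List.map_cons]

lemma decodeState_encodeState (ss : List (List Bucket)) : decodeState (encodeState ss) = ss := by
  have : (encodeState ss).foldr decodeStep ([], none) =
      (ss.map (List.map Encodable.encode), none) := by
    unfold encodeState
    induction ss with
    | nil => rfl
    | cons l ss ih => rw [List.flatMap_cons, List.foldr_append, ih, foldr_decodeStep_buckets,
        List.map_cons]
  rw [decodeState, this, List.map_map]
  have h : List.map decodeBucket ∘ List.map (Encodable.encode (α := Bucket)) = id := by
    funext l
    simp [Function.comp_def, decodeBucket_encode]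
  rw [h, List.map_id]

/-! Expectations of nonnegative functions. -/

section expectation

variable {σ τ : Type}

/-- Expectation of a nonnegative function. -/
noncomputable def expect (μ : PMF σ) (f : σ → ℝ≥0∞) : ℝ≥0∞ := ∑' x, μ x * f x

lemma expect_const (μ : PMF σ) (a : ℝ≥0∞) : expect μ (fun _ => a) = a := by
  simp [expect, ENNReal.tsum_mul_right, μ.tsum_coe]

lemma expect_pure (x : σ) (f : σ → ℝ≥0∞) : expect (PMF.pure x) f = f x := by
  rw [expect, tsum_eq_single x]
  · simp
  · intro y hy
    simp [hy]

lemma expect_bind (μ : PMF σ) (κ : σ → PMF τ) (f : τ → ℝ≥0∞) :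
    expect (μ.bind κ) f = expect μ fun x => expect (κ x) f := by
  simp only [expect, PMF.bind_apply, ← ENNReal.tsum_mul_right, ← ENNReal.tsum_mul_left]
  rw [ENNReal.tsum_comm]
  simp only [mul_assoc]

lemma expect_map (μ : PMF σ) (g : σ → τ) (f : τ → ℝ≥0∞) :
    expect (μ.map g) f = expect μ fun x => f (g x) := by
  rw [PMF.map, expect_bind]
  simp [expect_pure]

lemma expect_add (μ : PMF σ) (f g : σ → ℝ≥0∞) :
    expect μ (fun x => f x + g x) = expect μ f + expect μ g := by
  simp only [expect, mul_add, ENNReal.tsum_add]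

lemma expect_mul_left (μ : PMF σ) (a : ℝ≥0∞) (f : σ → ℝ≥0∞) :
    expect μ (fun x => a * f x) = a * expect μ f := by
  simp only [expect, mul_left_comm _ a, ENNReal.tsum_mul_left]

lemma expect_mul_right (μ : PMF σ) (a : ℝ≥0∞) (f : σ → ℝ≥0∞) :
    expect μ (fun x => f x * a) = expect μ f * a := by
  simp only [expect, ← mul_assoc, ENNReal.tsum_mul_right]

lemma expect_mono {μ : PMF σ} {f g : σ → ℝ≥0∞} (h : ∀ x ∈ μ.support, f x ≤ g x) :
    expect μ f ≤ expect μ g := by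
  refine ENNReal.tsum_le_tsum fun x => ?_
  by_cases hx : x ∈ μ.support
  · exact mul_le_mul_right (h x hx) _
  · simp [(μ.apply_eq_zero_iff x).2 hx]

lemma expect_congr {μ : PMF σ} {f g : σ → ℝ≥0∞} (h : ∀ x ∈ μ.support, f x = g x) :
    expect μ f = expect μ g :=
  le_antisymm (expect_mono fun x hx => (h x hx).le) (expect_mono fun x hx => (h x hx).ge)

lemma expect_indicator (μ : PMF σ) (s : Set σ) :
    expect μ (s.indicator 1) = μ.toOuterMeasure s := by
  rw [PMF.toOuterMeasure_apply]
  refine tsum_congr fun x => ?_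
  by_cases h : x ∈ s <;> simp [h]

/-- Reduces identities between laws to identities between sums of extended nonnegative numbers,
where no summability has to be checked. -/
lemma ext_of_expect {μ ν : PMF σ} (h : ∀ f, expect μ f = expect ν f) : μ = ν := by
  refine PMF.ext fun x => ?_
  rw [← PMF.toOuterMeasure_apply_singleton, ← PMF.toOuterMeasure_apply_singleton,
    ← expect_indicator, ← expect_indicator, h]

/-- The law of `g r`, where `r` is uniform in `{0, …, N}`. -/
noncomputable def draw (N : ℕ) (g : ℕ → σ) : PMF σ :=
  (PMF.uniformOfFintype (Fin (N + 1))).map fun r : Fin (N + 1) => g r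

lemma expect_draw (N : ℕ) (g : ℕ → σ) (f : σ → ℝ≥0∞) :
    expect (draw N g) f = ((N + 1 : ℕ) : ℝ≥0∞)⁻¹ * ∑ r ∈ Finset.range (N + 1), f (g r) := by
  rw [draw, expect_map, expect, tsum_fintype, Finset.mul_sum,
    Finset.sum_range fun r => ((N + 1 : ℕ) : ℝ≥0∞)⁻¹ * f (g r)]
  simp

lemma draw_zero (g : ℕ → σ) : draw 0 g = PMF.pure (g 0) :=
  ext_of_expect fun f => by rw [expect_draw, expect_pure]; simp

lemma mem_support_draw {N : ℕ} {g : ℕ → σ} {y : σ} (h : y ∈ (draw N g).support) :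
    ∃ r, y = g r := by
  obtain ⟨r, _, rfl⟩ := (PMF.mem_support_map_iff _ _ _).1 h
  exact ⟨r, rfl⟩

lemma sum_range_mul (a b : ℕ) (f : ℕ → ℕ → ℝ≥0∞) :
    ∑ r ∈ Finset.range ((a + 1) * b), f (r % (a + 1)) (r / (a + 1)) =
      ∑ i ∈ Finset.range (a + 1), ∑ j ∈ Finset.range b, f i j := by
  induction b with
  | zero => simp
  | succ b ih =>
    rw [Nat.mul_succ, Finset.sum_range_add, ih, ← Finset.sum_add_distrib.symm.trans
      (Finset.sum_congr rfl fun i _ => (Finset.sum_range_succ (f i) b).symm)]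
    congr 1
    refine Finset.sum_congr rfl fun i hi => ?_
    have hi := Finset.mem_range.1 hi
    rw [Nat.mul_add_mod, Nat.mod_eq_of_lt hi, Nat.mul_add_div (Nat.succ_pos a),
      Nat.div_eq_of_lt hi, add_zero]

/-- The remainder and the quotient of a uniform number below `(a + 1) * (b + 1)` by `a + 1` are
independent and uniform. -/
lemma draw_mul (a b : ℕ) (f : ℕ → ℕ → σ) :
    draw ((a + 1) * (b + 1) - 1) (fun r => f (r % (a + 1)) (r / (a + 1))) =
      (draw a id).bind fun i => draw b (f i) := by
  refine ext_of_expect fun g => ?_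
  simp only [expect_bind, expect_draw, id]
  rw [Nat.sub_add_cancel (Nat.mul_pos (Nat.succ_pos a) (Nat.succ_pos b)),
    sum_range_mul a (b + 1) fun i j => g (f i j), ← Finset.mul_sum, ← mul_assoc, Nat.cast_mul,
    ENNReal.mul_inv (Or.inr (by simp)) (Or.inr (by simp))]

/-- The law of a list of `n` independent variables. -/
noncomputable def listPow (μ : PMF σ) : ℕ → PMF (List σ)
  | 0 => PMF.pure []
  | n + 1 => μ.bind fun x => (listPow μ n).map (List.cons x)

lemma mem_support_listPow {μ : PMF σ} : ∀ {n : ℕ} {l : List σ}, l ∈ (listPow μ n).support →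
    l.length = n ∧ ∀ x ∈ l, x ∈ μ.support
  | 0, l, h => by
    rw [listPow, PMF.mem_support_pure_iff] at h
    simp [h]
  | n + 1, l, h => by
    obtain ⟨x, hx, h⟩ := (PMF.mem_support_bind_iff _ _ _).1 h
    obtain ⟨l', hl', rfl⟩ := (PMF.mem_support_map_iff _ _ _).1 h
    obtain ⟨h1, h2⟩ := mem_support_listPow hl'
    refine ⟨by simp [h1], fun y hy => ?_⟩
    rcases List.mem_cons.1 hy with rfl | hy
    · exact hx
    · exact h2 y hy

lemma listPow_pure (x : σ) : ∀ n, listPow (PMF.pure x) n = PMF.pure (List.replicate n x)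
  | 0 => rfl
  | n + 1 => by
    rw [listPow, listPow_pure x n, PMF.pure_bind, PMF.pure_map, List.replicate_succ]

lemma listPow_add (μ : PMF σ) (a b : ℕ) :
    listPow μ (a + b) = (listPow μ a).bind fun l => (listPow μ b).map (l ++ ·) := by
  induction a with
  | zero =>
    rw [zero_add, listPow, PMF.pure_bind]
    exact (PMF.map_id _).symm
  | succ a ih =>
    rw [Nat.succ_add, listPow, ih, listPow, PMF.bind_bind]
    congr 1
    funext x
    rw [PMF.map_bind, PMF.bind_map]
    congr 1
    funext l
    rw [PMF.map_comp]
    rfl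

lemma listPow_map (μ : PMF σ) (g : σ → τ) : ∀ n,
    listPow (μ.map g) n = (listPow μ n).map (List.map g)
  | 0 => by simp [listPow, PMF.pure_map]
  | n + 1 => by
    rw [listPow, listPow, listPow_map μ g n, PMF.bind_map, PMF.map_bind]
    congr 1
    funext x
    rw [Function.comp, PMF.map_comp, PMF.map_comp]
    rfl

/-! ### Many independent updates from a single draw. -/

variable (rng : σ → ℕ) (upd : σ → ℕ → σ)

/-- Range of the draw needed for updating all entries of a list. -/
def rangeAll (l : List σ) : ℕ := (l.map fun x => rng x + 1).prod - 1

/-- Update all entries of a list; the digits of `r` in a mixed radix are the single draws. -/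
def updateAll : List σ → ℕ → List σ
  | [], _ => []
  | x :: l, r => upd x (r % (rng x + 1)) :: updateAll l (r / (rng x + 1))

/-- Independent updates of the entries of a list. -/
noncomputable def stepAll (κ : σ → PMF σ) : List σ → PMF (List σ)
  | [] => PMF.pure []
  | x :: l => (κ x).bind fun y => (stepAll κ l).map (List.cons y)

lemma prod_map_succ_pos (l : List σ) : 0 < (l.map fun x => rng x + 1).prod :=
  List.prod_pos fun a ha => by
    obtain ⟨x, _, rfl⟩ := List.mem_map.1 ha
    exact Nat.succ_pos _

/-- The ranges differ between entries since each copy has its own bucket sizes; the digits in the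
corresponding mixed radix are independent by `draw_mul`. -/
lemma draw_updateAll : ∀ l : List σ,
    draw (rangeAll rng l) (updateAll rng upd l) = stepAll (fun x => draw (rng x) (upd x)) l
  | [] => by simp [rangeAll, draw_zero, updateAll, stepAll]
  | x :: l => by
    have h : rangeAll rng (x :: l) = (rng x + 1) * (rangeAll rng l + 1) - 1 := by
      rw [rangeAll, rangeAll, Nat.sub_add_cancel (prod_map_succ_pos rng l), List.map_cons,
        List.prod_cons]
    have h2 : updateAll rng upd (x :: l) = fun r =>
        (fun i j => upd x i :: updateAll rng upd l j) (r % (rng x + 1)) (r / (rng x + 1)) := rfl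
    rw [h, h2, draw_mul _ _ fun i j => upd x i :: updateAll rng upd l j, stepAll, ← draw_updateAll l]
    simp only [draw, PMF.bind_map, PMF.map_comp]
    rfl

lemma listPow_bind_stepAll (μ : PMF σ) (κ : σ → PMF σ) : ∀ n,
    (listPow μ n).bind (stepAll κ) = listPow (μ.bind κ) n
  | 0 => by simp [listPow, stepAll]
  | n + 1 => by
    rw [listPow, listPow, ← listPow_bind_stepAll μ κ n, PMF.bind_bind, PMF.bind_bind]
    congr 1
    funext x
    simp only [PMF.bind_map, PMF.map_bind, Function.comp_def, stepAll]
    rw [PMF.bind_comm]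

end expectation

/-! Independent copies of a one-copy procedure on bucket lists. -/

section lift

variable {α : Type} (rng : ℕ × ℕ × ℕ × ℕ → List Bucket → α → ℕ)
  (upd : ℕ × ℕ × ℕ × ℕ → List Bucket → α → ℕ → List Bucket)
  (copies : ℕ × ℕ × ℕ × ℕ → ℕ) (answer : ℕ × ℕ × ℕ × ℕ → List (List Bucket) → ℕ × ℕ)

/-- The streaming algorithm that runs independent copies of a procedure on bucket lists. -/
def copiesAlgorithm : StreamAlgorithm α where
  init p := encodeState (List.replicate (copies p) [])
  updateRange p s e := rangeAll (fun l => rng p l e) (decodeState s)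
  update p s e r :=
    encodeState (updateAll (fun l => rng p l e) (fun l => upd p l e) (decodeState s) r)
  queryRange _ _ := 0
  query p s _ := answer p (decodeState s)

/-- One random step of one copy. -/
noncomputable def copyStep (p : ℕ × ℕ × ℕ × ℕ) (l : List Bucket) (e : α) : PMF (List Bucket) :=
  draw (rng p l e) (upd p l e)

/-- The law of the state of one copy. -/
noncomputable def copyLaw (p : ℕ × ℕ × ℕ × ℕ) (stream : List α) (μ : PMF (List Bucket)) :
    PMF (List Bucket) :=
  stream.foldl (fun μ e => μ.bind fun l => copyStep rng upd p l e) μ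

lemma step_eq_draw (A : StreamAlgorithm α) (p : ℕ × ℕ × ℕ × ℕ) (s : List Bool) (e : α) :
    A.step p s e = draw (A.updateRange p s e) (A.update p s e) :=
  PMF.map_comp _ _ _

lemma answerLaw_eq_bind_draw (A : StreamAlgorithm α) (p : ℕ × ℕ × ℕ × ℕ) (stream : List α) :
    A.answerLaw p stream = (A.stateLaw p stream).bind fun s => draw (A.queryRange p s)
      fun r => ((A.query p s r).1 : ℝ) / ((A.query p s r).2 + 1) := by
  rw [StreamAlgorithm.answerLaw]
  congr 1
  funext s
  exact PMF.map_comp _ _ _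

/-- Decoding inverts encoding and one draw drives all copies independently, so a product law stays a
product law after every event. The randomness is thereby reduced to one copy. -/
lemma stateLaw_copiesAlgorithm (p : ℕ × ℕ × ℕ × ℕ) (stream : List α) :
    (copiesAlgorithm rng upd copies answer).stateLaw p stream =
      (listPow (copyLaw rng upd p stream (PMF.pure [])) (copies p)).map encodeState := by
  have key : ∀ (stream : List α) (μ : PMF (List Bucket)),
      stream.foldl (fun ν e => ν.bind fun s =>
        (copiesAlgorithm rng upd copies answer).step p s e)
        ((listPow μ (copies p)).map encodeState) =
      (listPow (copyLaw rng upd p stream μ) (copies p)).map encodeState := by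
    intro stream
    induction stream with
    | nil => intro μ; rfl
    | cons e stream ih =>
      intro μ
      rw [List.foldl_cons, copyLaw, List.foldl_cons, ← copyLaw, ← ih]
      congr 1
      rw [← listPow_bind_stepAll, PMF.bind_map, PMF.map_bind]
      congr 1
      funext ss
      simp only [copyStep]
      rw [← draw_updateAll]
      rw [Function.comp, step_eq_draw]
      have h := decodeState_encodeState ss
      have e1 : (copiesAlgorithm rng upd copies answer).updateRange p (encodeState ss) e =
          rangeAll (fun l => rng p l e) ss := by
        change rangeAll (fun l => rng p l e) (decodeState (encodeState ss)) = _
        rw [h]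
      have e2 : (copiesAlgorithm rng upd copies answer).update p (encodeState ss) e =
          encodeState ∘ updateAll (fun l => rng p l e) (fun l => upd p l e) ss := by
        funext r
        change encodeState (updateAll _ _ (decodeState (encodeState ss)) r) = _
        rw [h]
        rfl
      rw [e1, e2, draw, draw, PMF.map_comp]
      rfl
  rw [← key, listPow_pure, PMF.pure_map]
  rfl

lemma answerLaw_copiesAlgorithm (p : ℕ × ℕ × ℕ × ℕ) (stream : List α) :
    (copiesAlgorithm rng upd copies answer).answerLaw p stream =
      (listPow (copyLaw rng upd p stream (PMF.pure [])) (copies p)).map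
        fun ss => ((answer p ss).1 : ℝ) / ((answer p ss).2 + 1) := by
  rw [answerLaw_eq_bind_draw, stateLaw_copiesAlgorithm, PMF.bind_map, ← PMF.bind_pure_comp]
  congr 1
  funext ss
  simp only [Function.comp_def, copiesAlgorithm, decodeState_encodeState, draw_zero]

end lift

end WindowSketch

namespace WindowSketch

/-! Windows. -/

/-- A final tick ages every element by one. This is the recursion of the function `c` in `Good`,
whose value at `a` is the length of the window with parameter `a + 1`. -/
lemma timeWindow_concat_none (d : ℕ) (l : List (Option ℕ)) :
    timeWindow (d + 1) (l ++ [none]) = timeWindow d l := by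
  induction l with
  | nil => rfl
  | cons e l ih =>
    cases e with
    | none => simpa [timeWindow] using ih
    | some x => simp [timeWindow, ih]

lemma timeWindow_concat_some (d x : ℕ) (l : List (Option ℕ)) :
    timeWindow (d + 1) (l ++ [some x]) = timeWindow (d + 1) l ++ [x] := by
  induction l with
  | nil => rfl
  | cons e l ih =>
    cases e with
    | none => simpa [timeWindow] using ih
    | some y =>
      simp only [List.cons_append, timeWindow, ih, List.count_append]
      have : List.count (none : Option ℕ) [some x] = 0 := by simp
      rw [this, add_zero]
      split_ifs <;> rfl

lemma length_timeWindow_mono {d d' : ℕ} (h : d ≤ d') (l : List (Option ℕ)) :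
    (timeWindow d l).length ≤ (timeWindow d' l).length := by
  induction l with
  | nil => rfl
  | cons e l ih =>
    cases e with
    | none => exact ih
    | some x =>
      simp only [timeWindow]
      split_ifs <;> (try simp only [List.length_cons]) <;> omega

/-- With fewer than `t` ticks in the list, nothing has expired. -/
lemma count_timeWindow {t x : ℕ} {l : List (Option ℕ)} (h : l.count none < t) :
    (timeWindow t l).count x = l.count (some x) := by
  induction l with
  | nil => rfl
  | cons e l ih =>
    cases e with
    | none =>
      simp only [List.count_cons_self] at h
      simp [timeWindow, ih (by omega)]
    | some y =>
      have h' : l.count none < t := by simpa using h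
      rw [timeWindow, if_pos h', List.count_cons, List.count_cons, ih h']
      simp

lemma mem_timeWindow {t x : ℕ} {l : List (Option ℕ)} (h : x ∈ timeWindow t l) : some x ∈ l := by
  induction l with
  | nil => simp [timeWindow] at h
  | cons e l ih =>
    cases e with
    | none => exact List.mem_cons_of_mem _ (ih h)
    | some y =>
      simp only [timeWindow] at h
      split_ifs at h
      · rcases List.mem_cons.1 h with rfl | h
        · exact List.mem_cons_self
        · exact List.mem_cons_of_mem _ (ih h)
      · exact List.mem_cons_of_mem _ (ih h)

/-- In a sequence of arrivals, let the clock advance before every arrival. -/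
def timed (stream : List ℕ) : List (Option ℕ) := stream.flatMap fun x => [none, some x]

lemma count_none_timed (l : List ℕ) : (timed l).count none = l.length := by
  induction l with
  | nil => rfl
  | cons x l ih =>
    have : timed (x :: l) = none :: some x :: timed l := rfl
    simp [this, ih]

/-- Each arrival after `x` brings one tick, and the tick of `x` itself precedes `x`; so the age of
`x` is the number of later arrivals. -/
lemma timeWindow_timed (n : ℕ) (l : List ℕ) : timeWindow n (timed l) = seqWindow n l := by
  induction l with
  | nil => simp [timed, timeWindow, seqWindow]
  | cons x l ih =>
    have : timed (x :: l) = none :: some x :: timed l := rfl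
    rw [this, timeWindow, timeWindow, count_none_timed, ih]
    split_ifs with h
    · simp [seqWindow, Nat.sub_eq_zero_of_le h.le, Nat.sub_eq_zero_of_le (Nat.succ_le_of_lt h)]
    · have h2 : (x :: l).length - n = l.length - n + 1 := by simp; omega
      rw [seqWindow, seqWindow, h2, List.drop_succ_cons]

/-! The one-copy procedures. -/

/-- Range of the draw of one copy in the timestamp model. -/
def timeRange (_ : ℕ × ℕ × ℕ × ℕ) (l : List Bucket) (e : Option ℕ) : ℕ :=
  e.elim 0 fun x => mergeRange (insertNew x l) - 1

/-- Update of one copy in the timestamp model. -/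
def timeUpdate (p : ℕ × ℕ × ℕ × ℕ) (l : List Bucket) (e : Option ℕ) (u : ℕ) : List Bucket :=
  e.elim (tick p.2.1 l) fun x => mergeNewest u (insertNew x l)

/-- Range of the draw of one copy in the sequence model. -/
def seqRange (p : ℕ × ℕ × ℕ × ℕ) (l : List Bucket) (x : ℕ) : ℕ :=
  timeRange p (tick p.2.1 l) (some x)

/-- Update of one copy in the sequence model. -/
def seqUpdate (p : ℕ × ℕ × ℕ × ℕ) (l : List Bucket) (x : ℕ) (u : ℕ) : List Bucket :=
  timeUpdate p (tick p.2.1 l) (some x) u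

/-- The evolution is linear in the initial law, which allows conditioning on the first step. -/
lemma copyLaw_bind {α : Type} (rng : ℕ × ℕ × ℕ × ℕ → List Bucket → α → ℕ)
    (upd : ℕ × ℕ × ℕ × ℕ → List Bucket → α → ℕ → List Bucket) (p : ℕ × ℕ × ℕ × ℕ)
    (stream : List α) {τ : Type} (μ : PMF τ) (κ : τ → PMF (List Bucket)) :
    copyLaw rng upd p stream (μ.bind κ) = μ.bind fun x => copyLaw rng upd p stream (κ x) := by
  unfold copyLaw
  induction stream generalizing κ with
  | nil => rfl
  | cons e stream ih => simp only [List.foldl_cons, PMF.bind_bind, ih]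

lemma copyStep_none (p : ℕ × ℕ × ℕ × ℕ) (l : List Bucket) :
    copyStep timeRange timeUpdate p l none = PMF.pure (tick p.2.1 l) :=
  draw_zero _

lemma copyLaw_seq (p : ℕ × ℕ × ℕ × ℕ) (stream : List ℕ) (μ : PMF (List Bucket)) :
    copyLaw seqRange seqUpdate p stream μ = copyLaw timeRange timeUpdate p (timed stream) μ := by
  induction stream generalizing μ with
  | nil => rfl
  | cons x stream ih =>
    have : timed (x :: stream) = none :: some x :: timed stream := rfl
    rw [this]
    unfold copyLaw at ih ⊢
    simp only [List.foldl_cons]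
    rw [ih, PMF.bind_bind]
    congr 1
    congr 1
    funext l
    rw [copyStep_none, PMF.pure_bind]
    rfl

/-! ### Reachable states and the moments of the estimate of one copy. -/

variable {t m : ℕ}

/-- All reachable bucket lists satisfy the invariants. -/
lemma good_sparse_of_mem_support {p : ℕ × ℕ × ℕ × ℕ} (ht : 1 ≤ p.2.1) (stream : List (Option ℕ))
    (hs : ∀ x, some x ∈ stream → 1 ≤ x ∧ x ≤ m) :
    ∀ l ∈ (copyLaw timeRange timeUpdate p stream (PMF.pure [])).support,
      Good p.2.1 m (fun a => (timeWindow (a + 1) stream).length) l ∧ Sparse l := by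
  induction stream using List.reverseRecOn with
  | nil =>
    intro l hl
    rw [copyLaw, List.foldl_nil, PMF.mem_support_pure_iff] at hl
    rw [hl]
    exact ⟨trivial, trivial⟩
  | append_singleton stream e ih =>
    intro l hl
    rw [copyLaw, List.foldl_append, List.foldl_cons, List.foldl_nil,
      PMF.mem_support_bind_iff] at hl
    obtain ⟨l', hl', hl⟩ := hl
    obtain ⟨h1, h2⟩ := ih (fun x hx => hs x (by simp [hx])) l' hl'
    cases e with
    | none =>
      rw [copyStep_none, PMF.mem_support_pure_iff] at hl
      rw [hl]
      exact ⟨h1.tick fun a => by rw [timeWindow_concat_none], h2.tick h1⟩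
    | some x =>
      obtain ⟨r, rfl⟩ := mem_support_draw hl
      obtain ⟨hx1, hx2⟩ := hs x (by simp)
      exact good_sparse_arrive r hx2 ht hx1
        (fun a => by rw [timeWindow_concat_some, List.length_append]; rfl) h1 h2

/-- Evolution of a sample. -/
def evolve (t : ℕ) (stream : List (Option ℕ)) (x : Sample) : Sample :=
  stream.foldl (fun x e => e.elim (ageSample t x) fun y => hitSample y x) x

lemma ageSample_expired (t : ℕ) : ageSample t (0, t, 0) = (0, t, 0) :=
  if_neg (by simp)

lemma evolve_expired {stream : List (Option ℕ)} (hs : ∀ x, some x ∈ stream → 1 ≤ x) :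
    evolve t stream (0, t, 0) = (0, t, 0) := by
  induction stream with
  | nil => rfl
  | cons e stream ih =>
    have ih := ih fun x hx => hs x (by simp [hx])
    cases e with
    | none => rw [evolve, List.foldl_cons, Option.elim_none, ageSample_expired]; exact ih
    | some y =>
      have : hitSample y (0, t, 0) = (0, t, 0) :=
        if_neg (by have := hs y (by simp); simp; omega)
      rw [evolve, List.foldl_cons, Option.elim_some, this]; exact ih

/-- The fate of a sample is deterministic once it is never replaced: ticks raise its age, equal
elements its count, and after expiry it stays frozen. -/
lemma evolve_eq {stream : List (Option ℕ)} (hs : ∀ x, some x ∈ stream → 1 ≤ x) (y a r : ℕ)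
    (ha : a < t) : evolve t stream (y, a, r) =
      if a + stream.count none < t then (y, a + stream.count none, r + stream.count (some y))
      else (0, t, 0) := by
  induction stream generalizing a r with
  | nil => simp [evolve, ha]
  | cons e stream ih =>
    have hs' : ∀ x, some x ∈ stream → 1 ≤ x := fun x hx => hs x (by simp [hx])
    cases e with
    | none =>
      rw [evolve, List.foldl_cons, Option.elim_none, ← evolve]
      by_cases h : a + 1 < t
      · rw [ageSample, if_pos (by simpa using h), ih hs' _ _ h]
        simp only [List.count_cons_self, add_assoc, add_comm 1, List.count_cons_of_ne, ne_eq,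
          reduceCtorEq, not_false_eq_true]
      · rw [ageSample, if_neg (by simpa using h), evolve_expired hs', if_neg]
        simp only [List.count_cons_self]; omega
    | some x =>
      rw [evolve, List.foldl_cons, Option.elim_some, ← evolve]
      by_cases h : y = x
      · subst h
        rw [hitSample, if_pos rfl, ih hs' _ _ ha]
        simp only [List.count_cons_self, add_assoc, add_comm 1, List.count_cons_of_ne, ne_eq,
          reduceCtorEq, not_false_eq_true]
      · rw [hitSample, if_neg (by simpa using h), ih hs' _ _ ha]
        have : x ≠ y := fun h' => h h'.symm
        simp [this]

/-- The sum over the arrivals of `φ` at the final value of the sample taken there. -/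
def arrivalSum (t : ℕ) (φ : Sample → ℕ) : List (Option ℕ) → ℕ
  | [] => 0
  | none :: l => arrivalSum t φ l
  | some y :: l => φ (evolve t l (y, 0, 1)) + arrivalSum t φ l

/-- The linear statistics are unbiased. -/
lemma expect_weight {p : ℕ × ℕ × ℕ × ℕ} (ht : 1 ≤ p.2.1) (φ : Sample → ℕ)
    (hφ : φ (0, p.2.1, 0) = 0) (stream : List (Option ℕ))
    (hs : ∀ x, some x ∈ stream → 1 ≤ x ∧ x ≤ m) (c : ℕ → ℕ) (l : List Bucket)
    (hl : Good p.2.1 m c l) :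
    expect (copyLaw timeRange timeUpdate p stream (PMF.pure l)) (fun l => (weight φ l : ℝ≥0∞)) =
      (weight (fun x => φ (evolve p.2.1 stream x)) l + arrivalSum p.2.1 φ stream : ℕ) := by
  -- The induction removes the first event, so that the future of a sample is composed into φ and
  -- the test function of the remaining stream is again a function of samples.
  induction stream generalizing c l with
  | nil => simp [copyLaw, expect_pure, evolve, arrivalSum]
  | cons e stream ih =>
    have hs' : ∀ x, some x ∈ stream → 1 ≤ x ∧ x ≤ m := fun x hx => hs x (by simp [hx])
    have h1 : copyLaw timeRange timeUpdate p (e :: stream) (PMF.pure l) =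
        (copyStep timeRange timeUpdate p l e).bind fun l' =>
          copyLaw timeRange timeUpdate p stream (PMF.pure l') := by
      rw [copyLaw, List.foldl_cons, PMF.pure_bind, ← copyLaw, ← copyLaw_bind, PMF.bind_pure]
    rw [h1, expect_bind]
    cases e with
    | none =>
      rw [copyStep_none, expect_pure,
        -- Only `c' (a + 1) = c a` matters; the value at age 0 is arbitrary.
        ih hs' (fun a => c (a - 1)) _ (hl.tick fun _ => rfl)]
      rw [weight_tick (by rw [evolve_expired fun x hx => (hs' x hx).1, hφ]) l hl]
      rfl
    | some x =>
      obtain ⟨hx1, hx2⟩ := hs x (by simp)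
      have hg := hl.insertNew (c' := fun a => c a + 1) hx2 ht hx1 fun _ => rfl
      have h2 : ∀ r, expect (copyLaw timeRange timeUpdate p stream
          (PMF.pure (mergeNewest r (insertNew x l)))) (fun l => (weight φ l : ℝ≥0∞)) =
          (weight (fun x => φ (evolve p.2.1 stream x)) (mergeNewest r (insertNew x l)) +
            arrivalSum p.2.1 φ stream : ℕ) := fun r => ih hs' _ _ (hg.mergeNewest r)
      have h3 : copyStep timeRange timeUpdate p l (some x) =
        draw (mergeRange (insertNew x l) - 1) fun r => mergeNewest r (insertNew x l) := rfl
      -- The arrival contributes a bucket of size 1, hence one summand of `arrivalSum`; the merge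
      -- does not change the average.
      rw [h3, expect_draw, Finset.sum_congr rfl fun r _ => h2 r, ← Nat.cast_sum,
        Finset.sum_add_distrib, sum_weight_mergeNewest, Finset.sum_const, Finset.card_range,
        smul_eq_mul, ← mul_add, Nat.cast_mul, ← mul_assoc,
        ENNReal.inv_mul_cancel (by simp) (by simp), one_mul, weight_insertNew, add_assoc]
      rfl

/-- The sum of `ψ` over the ranks (counted from the end, among equal elements) of the entries. -/
def rankSum (ψ : ℕ → ℕ) : List ℕ → ℕ
  | [] => 0
  | x :: w => ψ (w.count x + 1) + rankSum ψ w

/-- Everything that arrives after an active element is active too, so the occurrences counted by its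
sample are those within the window. An expired sample records 0 occurrences and is killed by `h0`.
-/
lemma arrivalSum_eq_rankSum (ht : 1 ≤ t) (ψ : ℕ → ℕ) (h0 : ψ 0 = 0) {stream : List (Option ℕ)}
    (hs : ∀ x, some x ∈ stream → 1 ≤ x) :
    arrivalSum t (fun x => ψ x.2.2) stream = rankSum ψ (timeWindow t stream) := by
  induction stream with
  | nil => rfl
  | cons e stream ih =>
    have hs' : ∀ x, some x ∈ stream → 1 ≤ x := fun x hx => hs x (by simp [hx])
    cases e with
    | none => exact ih hs'
    | some y =>
      rw [arrivalSum, timeWindow, ih hs', evolve_eq hs' _ _ _ ht, zero_add]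
      split_ifs with h
      · rw [rankSum, count_timeWindow h, add_comm 1]
      · simp [h0]

/-- First and second moment of the estimate of one copy. -/
lemma expect_estimate {p : ℕ × ℕ × ℕ × ℕ} (ht : 1 ≤ p.2.1) (ψ : ℕ → ℕ) (h0 : ψ 0 = 0)
    (stream : List (Option ℕ)) (hs : ∀ x, some x ∈ stream → 1 ≤ x ∧ x ≤ m) :
    expect (copyLaw timeRange timeUpdate p stream (PMF.pure []))
        (fun l => (weight (fun x => ψ x.2.2) l : ℝ≥0∞)) =
      (rankSum ψ (timeWindow p.2.1 stream) : ℕ) ∧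
    expect (copyLaw timeRange timeUpdate p stream (PMF.pure []))
        (fun l => ((weight (fun x => ψ x.2.2) l ^ 2 : ℕ) : ℝ≥0∞)) ≤
      (2 * (timeWindow p.2.1 stream).length *
        rankSum (fun r => ψ r ^ 2) (timeWindow p.2.1 stream) : ℕ) := by
  have hs1 : ∀ x, some x ∈ stream → 1 ≤ x := fun x hx => (hs x hx).1
  have key : ∀ ψ : ℕ → ℕ, ψ 0 = 0 → expect (copyLaw timeRange timeUpdate p stream (PMF.pure []))
        (fun l => (weight (fun x => ψ x.2.2) l : ℝ≥0∞)) =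
      (rankSum ψ (timeWindow p.2.1 stream) : ℕ) := by
    intro ψ h0
    rw [expect_weight ht _ h0 stream hs (fun _ => 0) [] trivial, weight_nil, zero_add,
      arrivalSum_eq_rankSum ht ψ h0 hs1]
  refine ⟨key ψ h0, ?_⟩
  rw [Nat.cast_mul, ← key (fun r => ψ r ^ 2) (by simp [h0]), ← expect_mul_left]
  refine expect_mono fun l hl => ?_
  rw [← Nat.cast_mul]
  refine Nat.cast_le.2 ((weight_sq_le _ l).trans (Nat.mul_le_mul_right _ ?_))
  -- The age of the oldest bucket is below the window parameter, so the elements of at most that age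
  -- lie in the window.
  obtain ⟨hg, -⟩ := good_sparse_of_mem_support ht stream hs l hl
  cases l with
  | nil => simp
  | cons b l =>
    exact hg.total_le.trans (Nat.mul_le_mul_left 2 (length_timeWindow_mono hg.2.2.2.1 stream))

end WindowSketch

namespace WindowSketch

/-! Medians of sums of independent estimates. -/

/-- The sums of the first `b` groups of `a` consecutive entries. -/
def groupSums (a b : ℕ) (ys : List ℕ) : List ℕ :=
  (List.range b).map fun j => ((ys.drop (j * a)).take a).sum

lemma exists_median (vs : List ℕ) : ∃ y, vs.length ≤ 2 * vs.countP (· ≤ y) := by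
  refine ⟨vs.sum, ?_⟩
  rw [List.countP_eq_length.2 fun v hv => by simpa using List.single_le_sum (by simp) v hv]
  omega

/-- The lower median. -/
def median (vs : List ℕ) : ℕ := Nat.find (exists_median vs)

-- A median below `lo` would make at least half of the entries bad. A median above `hi` exceeds
-- every good entry, and then `median vs - 1` already has more than half of the entries below or
-- equal to it, against minimality.
open Classical in
lemma median_mem_Icc {vs : List ℕ} {lo hi : ℝ}
    (h : 2 * vs.countP (fun v : ℕ => ¬ (lo ≤ v ∧ (v : ℝ) ≤ hi)) < vs.length) :
    lo ≤ median vs ∧ (median vs : ℝ) ≤ hi := by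
  have hsplit := List.length_eq_countP_add_countP (fun v : ℕ => decide (¬ (lo ≤ v ∧ (v : ℝ) ≤ hi)))
    (l := vs)
  constructor
  · by_contra hlt
    have h1 := Nat.find_spec (exists_median vs)
    have h2 : vs.countP (· ≤ median vs) ≤
        vs.countP (fun v : ℕ => ¬ (lo ≤ v ∧ (v : ℝ) ≤ hi)) := by
      refine List.countP_mono_left fun v _ hv => ?_
      have hv : v ≤ median vs := by simpa using hv
      have : (v : ℝ) ≤ median vs := by exact_mod_cast hv
      simp only [decide_eq_true_eq]
      intro hc
      linarith [hc.1]
    change vs.length ≤ 2 * vs.countP (· ≤ median vs) at h1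
    omega
  · by_contra hlt
    push Not at hlt
    obtain ⟨v, hv, hgood⟩ : ∃ v ∈ vs, lo ≤ v ∧ (v : ℝ) ≤ hi := by
      by_contra hno
      push Not at hno
      have : vs.countP (fun v : ℕ => ¬ (lo ≤ v ∧ (v : ℝ) ≤ hi)) = vs.length :=
        List.countP_eq_length.2 fun v hv => by
          simpa only [decide_eq_true_eq, not_and, not_le] using hno v hv
      omega
    have hpos : 0 < median vs := by
      have : (0 : ℝ) < median vs := lt_of_le_of_lt ((Nat.cast_nonneg v).trans hgood.2) hlt
      exact_mod_cast this
    have h1 := Nat.find_min (exists_median vs) (m := median vs - 1) (Nat.sub_lt hpos one_pos)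
    refine h1 ?_
    have h2 : vs.countP (fun v : ℕ => ¬ decide (¬ (lo ≤ (v : ℝ) ∧ (v : ℝ) ≤ hi)) = true) ≤
        vs.countP (· ≤ median vs - 1) := by
      refine List.countP_mono_left fun v _ hv => ?_
      have hv : lo ≤ (v : ℝ) ∧ (v : ℝ) ≤ hi := by simpa using hv
      have : v < median vs := by exact_mod_cast lt_of_le_of_lt hv.2 hlt
      simp only [decide_eq_true_eq]
      omega
    omega

/-! ### Chebyshev's inequality and amplification by medians. -/

section amplification

variable {σ : Type}

lemma expect_listPow_succ (μ : PMF σ) (n : ℕ) (f : List σ → ℝ≥0∞) :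
    expect (listPow μ (n + 1)) f =
      expect μ fun x => expect (listPow μ n) fun l => f (x :: l) := by
  rw [listPow, expect_bind]
  simp only [expect_map]

lemma expect_sum (μ : PMF ℕ) (M : ℕ) (h1 : expect μ (fun x => (x : ℝ≥0∞)) = M) : ∀ a : ℕ,
    expect (listPow μ a) (fun l => (l.sum : ℝ≥0∞)) = (a * M : ℕ)
  | 0 => by simp [listPow, expect_pure]
  | a + 1 => by
    rw [expect_listPow_succ]
    simp only [List.sum_cons, Nat.cast_add, expect_add, expect_const, expect_sum μ M h1 a, h1]
    push_cast
    ring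

/-- Expanding the square, the cross terms factor by independence. Using V as a bound for the
variance wastes the squared mean of each summand, which is discarded as a surplus `M ^ 2` in each
induction step. -/
lemma expect_sum_sq (μ : PMF ℕ) (M V : ℕ) (h1 : expect μ (fun x => (x : ℝ≥0∞)) = M)
    (h2 : expect μ (fun x => ((x ^ 2 : ℕ) : ℝ≥0∞)) ≤ V) : ∀ a : ℕ,
    expect (listPow μ a) (fun l => ((l.sum ^ 2 : ℕ) : ℝ≥0∞)) ≤ (a * V + (a * M) ^ 2 : ℕ)
  | 0 => by simp [listPow, expect_pure]
  | a + 1 => by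
    have e : ∀ (x : ℕ) (l : List ℕ), (((x :: l).sum ^ 2 : ℕ) : ℝ≥0∞) =
        (x ^ 2 : ℕ) + (2 * (x : ℝ≥0∞)) * (l.sum : ℕ) + (l.sum ^ 2 : ℕ) := by
      intro x l
      rw [List.sum_cons]
      push_cast
      ring
    rw [expect_listPow_succ]
    simp only [e, expect_add, expect_const, expect_mul_left, expect_mul_right,
      expect_sum μ M h1 a, h1]
    refine (add_le_add (add_le_add_left h2 _) (expect_sum_sq μ M V h1 h2 a)).trans ?_
    have e2 : (((a + 1) * V + ((a + 1) * M) ^ 2 : ℕ) : ℝ≥0∞) =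
        V + 2 * M * (a * M : ℕ) + (a * V + (a * M) ^ 2 : ℕ) + (M ^ 2 : ℕ) := by
      push_cast
      ring
    rw [e2]
    exact le_self_add

/-- Chebyshev's inequality for sums of independent variables. -/
lemma expect_deviation (μ : PMF ℕ) (M V a : ℕ) (h1 : expect μ (fun x => (x : ℝ≥0∞)) = M)
    (h2 : expect μ (fun x => ((x ^ 2 : ℕ) : ℝ≥0∞)) ≤ V) {τ : ℝ} (hτ : 0 < τ) :
    ENNReal.ofReal (τ ^ 2) *
      expect (listPow μ a) ({l | τ < |(l.sum : ℝ) - a * M|}.indicator 1) ≤ (a * V : ℕ) := by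
  set s : Set (List ℕ) := {l | τ < |(l.sum : ℝ) - a * M|}
  -- This is `τ² 1_s ≤ (S - aM)²` with the cross term moved to the left, because extended
  -- nonnegative numbers have no useful subtraction. The finite term is cancelled after taking
  -- expectations.
  have key : ∀ l : List ℕ, ENNReal.ofReal (τ ^ 2) * s.indicator 1 l +
      (2 * (a * M) : ℕ) * (l.sum : ℝ≥0∞) ≤ ((l.sum ^ 2 : ℕ) : ℝ≥0∞) + ((a * M) ^ 2 : ℕ) := by
    intro l
    rw [← Nat.cast_mul, ← Nat.cast_add]
    have hmem : l ∈ s ↔ τ < |(l.sum : ℝ) - a * M| := Iff.rfl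
    by_cases hl : l ∈ s
    · rw [hmem] at hl
      rw [Set.indicator_of_mem (hmem.2 hl)]
      generalize l.sum = n at hl
      rw [Pi.one_apply, mul_one, ← ENNReal.ofReal_natCast,
        ← ENNReal.ofReal_natCast, ← ENNReal.ofReal_add (sq_nonneg _) (Nat.cast_nonneg _)]
      refine ENNReal.ofReal_le_ofReal ?_
      have : τ ^ 2 ≤ ((n : ℝ) - a * M) ^ 2 := by
        rw [← sq_abs ((n : ℝ) - a * M)]
        exact pow_le_pow_left₀ hτ.le (le_of_lt hl) 2
      push_cast
      nlinarith
    · rw [Set.indicator_of_notMem hl, mul_zero, zero_add]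
      refine Nat.cast_le.2 ?_
      generalize l.sum = n
      zify
      nlinarith [sq_nonneg ((n : ℤ) - a * M)]
  have h3 := expect_mono (μ := listPow μ a) fun l _ => key l
  simp only [expect_add, expect_mul_left, expect_const, expect_sum μ M h1 a] at h3
  have h4 := h3.trans (add_le_add_left (expect_sum_sq μ M V h1 h2 a) _)
  have e : ((a * V + (a * M) ^ 2 : ℕ) : ℝ≥0∞) + ((a * M) ^ 2 : ℕ) =
      (a * V : ℕ) + (2 * (a * M) : ℕ) * (a * M : ℕ) := by
    push_cast
    ring
  rw [e] at h4
  exact (ENNReal.add_le_add_iff_right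
    (ENNReal.mul_ne_top (ENNReal.natCast_ne_top _) (ENNReal.natCast_ne_top _))).1 h4

open Classical in
/-- If failures have probability at most `1/15`, at least half of the trials fail only with
exponentially small probability. -/
lemma toOuterMeasure_half_fail (μ : PMF σ) (s : Set σ)
    (hs : 15 * expect μ (s.indicator 1) ≤ 1) (b : ℕ) :
    (listPow μ b).toOuterMeasure {l | b ≤ 2 * l.countP (· ∈ s)} ≤ (2 ^ b)⁻¹ := by
  -- Exponential moment with base 16: a failure probability q gives the factor `15 q + 1 ≤ 2` per
  -- trial, while half of the trials failing makes the power at least `16^(b/2) = 4^b`.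
  have h1 : ∀ b, expect (listPow μ b) (fun l => (16 : ℝ≥0∞) ^ l.countP (· ∈ s)) ≤ 2 ^ b := by
    intro b
    induction b with
    | zero => simp [listPow, expect_pure]
    | succ b ih =>
      have e : ∀ (x : σ) (l : List σ), (16 : ℝ≥0∞) ^ (x :: l).countP (· ∈ s) =
          (15 * s.indicator 1 x + 1) * 16 ^ l.countP (· ∈ s) := by
        intro x l
        by_cases hx : x ∈ s
        · rw [List.countP_cons_of_pos (by simpa using hx), Set.indicator_of_mem hx, pow_succ,
            mul_comm]
          norm_num
        · rw [List.countP_cons_of_neg (by simpa using hx), Set.indicator_of_notMem hx]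
          simp
      rw [expect_listPow_succ]
      simp only [e, expect_mul_left, expect_mul_right, expect_add, expect_const]
      rw [pow_succ, mul_comm (2 ^ b)]
      refine mul_le_mul' ?_ ih
      calc _ ≤ (1 : ℝ≥0∞) + 1 := add_le_add_left hs 1
        _ = 2 := by norm_num
  have h2 : 4 ^ b * (listPow μ b).toOuterMeasure {l | b ≤ 2 * l.countP (· ∈ s)} ≤ 2 ^ b := by
    rw [← expect_indicator, ← expect_mul_left]
    refine (expect_mono fun l _ => ?_).trans (h1 b)
    by_cases hl : b ≤ 2 * l.countP (· ∈ s)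
    · rw [Set.indicator_of_mem (by exact hl), Pi.one_apply, mul_one]
      calc (4 : ℝ≥0∞) ^ b ≤ 4 ^ (2 * l.countP (· ∈ s)) :=
            pow_le_pow_right₀ (by norm_num) hl
        _ = 16 ^ l.countP (· ∈ s) := by rw [pow_mul]; norm_num
    · rw [Set.indicator_of_notMem (by exact hl), mul_zero]
      exact zero_le
  have h3 : (4 : ℝ≥0∞) ^ b = 2 ^ b * 2 ^ b := by
    rw [← mul_pow]; norm_num
  rw [h3, mul_assoc] at h2
  have h4 : (2 : ℝ≥0∞) ^ b * (listPow μ b).toOuterMeasure {l | b ≤ 2 * l.countP (· ∈ s)} ≤ 1 := by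
    refine (ENNReal.mul_le_mul_iff_right (a := 2 ^ b) (by simp) (by simp)).1 ?_
    rwa [mul_one]
  rwa [ENNReal.le_inv_iff_mul_le, mul_comm]

lemma groupSums_append (a b : ℕ) (l ys : List ℕ) (hl : l.length = a) :
    groupSums a (b + 1) (l ++ ys) = l.sum :: groupSums a b ys := by
  rw [groupSums, List.range_succ_eq_map, List.map_cons, List.map_map, groupSums]
  congr 1
  · rw [zero_mul, List.drop_zero, ← hl, List.take_left]
  · refine List.map_congr_left fun j _ => ?_
    rw [Function.comp, Nat.succ_mul, add_comm (j * a), ← List.drop_drop, ← hl, List.drop_left]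

/-- Disjoint groups of independent copies are independent, so the group sums are again a list of
independent variables. -/
lemma map_groupSums (μ : PMF ℕ) (a : ℕ) : ∀ b : ℕ,
    (listPow μ (a * b)).map (groupSums a b) = listPow ((listPow μ a).map List.sum) b
  | 0 => by rw [mul_zero, listPow, PMF.pure_map]; rfl
  | b + 1 => by
    rw [show a * (b + 1) = a + a * b by ring, listPow_add, listPow, ← map_groupSums μ a b, PMF.map_bind,
      PMF.bind_map]
    refine ext_of_expect fun f => ?_
    rw [expect_bind, expect_bind]
    refine expect_congr fun l hl => ?_
    simp only [Function.comp, expect_map]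
    simp only [groupSums_append a b l _ (mem_support_listPow hl).1]

/-- The median of `b` sums of `a` independent estimates is close to its target. -/
lemma median_concentration (μ : PMF σ) (Y : σ → ℕ) (M V a b : ℕ) {τ : ℝ} (hτ : 0 < τ)
    (h1 : expect μ (fun x => (Y x : ℝ≥0∞)) = M)
    (h2 : expect μ (fun x => ((Y x ^ 2 : ℕ) : ℝ≥0∞)) ≤ V) (hV : 15 * ((a * V : ℕ) : ℝ) ≤ τ ^ 2) :
    1 - (2 ^ b)⁻¹ ≤ (listPow μ (a * b)).toOuterMeasure
      {ss | |(median (groupSums a b (ss.map Y)) : ℝ) - a * M| ≤ τ} := by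
  classical
  set ν := (listPow (μ.map Y) a).map List.sum
  set s : Set ℕ := {v | τ < |(v : ℝ) - a * M|} with hs
  have hfail : 15 * expect ν (s.indicator 1) ≤ 1 := by
    have h3 := expect_deviation (μ.map Y) M V a (by rw [expect_map, h1]) (by rwa [expect_map]) hτ
    have h4 : expect ν (s.indicator 1) =
        expect (listPow (μ.map Y) a) ({l | τ < |(l.sum : ℝ) - a * M|}.indicator 1) := by
      rw [expect_map]
      rfl
    rw [← h4] at h3
    have h5 : (15 : ℝ≥0∞) * (a * V : ℕ) ≤ ENNReal.ofReal (τ ^ 2) := by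
      have : (15 : ℝ≥0∞) * (a * V : ℕ) = ENNReal.ofReal (15 * ((a * V : ℕ) : ℝ)) := by
        rw [ENNReal.ofReal_mul (by norm_num), ENNReal.ofReal_natCast]
        norm_num
      rw [this]
      exact ENNReal.ofReal_le_ofReal hV
    have hpos : ENNReal.ofReal (τ ^ 2) ≠ 0 := by simp [hτ.ne']
    refine (ENNReal.mul_le_mul_iff_right hpos ENNReal.ofReal_ne_top).1 ?_
    rw [mul_one, mul_left_comm]
    exact (mul_le_mul_right h3 15).trans h5
  have hmeas : (listPow μ (a * b)).toOuterMeasure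
      {ss | |(median (groupSums a b (ss.map Y)) : ℝ) - a * M| ≤ τ} =
      expect (listPow ν b) ({vs | |(median vs : ℝ) - a * M| ≤ τ}.indicator 1) := by
    rw [← map_groupSums, listPow_map, expect_map, expect_map, ← expect_indicator]
    rfl
  have hlen : ∀ vs ∈ (listPow ν b).support, (1 : ℝ≥0∞) ≤
      {vs | |(median vs : ℝ) - a * M| ≤ τ}.indicator 1 vs +
        {l : List ℕ | b ≤ 2 * l.countP (· ∈ s)}.indicator 1 vs := by
    intro vs hvs
    have hl := (mem_support_listPow hvs).1
    by_cases hb : b ≤ 2 * vs.countP (· ∈ s)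
    · rw [Set.indicator_of_mem (s := {l : List ℕ | b ≤ 2 * l.countP (· ∈ s)}) (by exact hb)]
      exact le_add_self
    · have : 2 * vs.countP (fun v : ℕ => ¬ ((a * M - τ : ℝ) ≤ v ∧ (v : ℝ) ≤ a * M + τ))
          < vs.length := by
        rw [hl]
        refine lt_of_le_of_lt (Nat.mul_le_mul_left 2 ?_) (not_le.1 hb)
        refine List.countP_mono_left fun v _ hv => ?_
        simp only [decide_eq_true_eq] at hv ⊢
        rw [hs, Set.mem_ofPred_eq]
        by_contra hle
        rw [not_lt, abs_le] at hle
        exact hv ⟨by linarith, by linarith⟩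
      obtain ⟨h6, h7⟩ := median_mem_Icc this
      rw [Set.indicator_of_mem (s := {vs | |(median vs : ℝ) - a * M| ≤ τ})]
      · exact le_self_add
      · change |(median vs : ℝ) - a * M| ≤ τ
        rw [abs_le]
        constructor <;> linarith
  have h8 := expect_mono hlen
  rw [expect_const, expect_add] at h8
  rw [hmeas, tsub_le_iff_right]
  refine h8.trans (add_le_add_right ?_ _)
  rw [expect_indicator]
  exact toOuterMeasure_half_fail ν s hfail b

end amplification

end WindowSketch

namespace WindowSketch

/-! Computable approximations of real powers. -/

/-- Unbounded search is partial recursive, and the existence hypothesis makes it total. -/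
lemma computable_find {α : Type} [Primcodable α] {p : α → ℕ → Bool} (hp : Computable₂ p)
    (h : ∀ a, ∃ n, p a n = true) : Computable fun a => Nat.find (h a) := by
  refine Partrec.of_eq_tot (Partrec.rfind (p := fun a n => Part.some (p a n)) hp.partrec₂)
    fun a => ?_
  refine Nat.mem_rfind.2 ⟨?_, fun {m} hm => ?_⟩
  · simpa using (Nat.find_spec (h a)).symm
  · have := Nat.find_min (h a) hm
    simpa using (Bool.eq_false_iff.2 this).symm

lemma primrec_pow : Primrec₂ ((· ^ ·) : ℕ → ℕ → ℕ) := Primrec₂.unpaired'.1 Nat.Primrec.pow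

lemma pow_le_rpow_pow {r a N : ℕ} {k : ℝ} (ha : 1 ≤ a) (h : (a : ℝ) ≤ k * N) :
    (r : ℝ) ^ a ≤ ((r : ℝ) ^ k) ^ N := by
  rcases Nat.eq_zero_or_pos r with rfl | hr
  · rw [Nat.cast_zero, zero_pow (by omega)]
    positivity
  · rw [← Real.rpow_natCast, ← Real.rpow_natCast, ← Real.rpow_mul (Nat.cast_nonneg r)]
    exact Real.rpow_le_rpow_of_exponent_le (by exact_mod_cast hr) h

lemma rpow_pow_le_pow {r b N : ℕ} {k : ℝ} (hk : 0 < k) (hN : N ≠ 0) (h : k * N ≤ b) :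
    ((r : ℝ) ^ k) ^ N ≤ (r : ℝ) ^ b := by
  rcases Nat.eq_zero_or_pos r with rfl | hr
  · rw [Nat.cast_zero, Real.zero_rpow hk.ne', zero_pow hN]
    positivity
  · rw [← Real.rpow_natCast, ← Real.rpow_natCast, ← Real.rpow_mul (Nat.cast_nonneg r)]
    exact Real.rpow_le_rpow_of_exponent_le (by exact_mod_cast hr) h

/-- The pair `n = (i, y)` certifies that `y` is within `1` of `(D + 1) * r ^ k`, where `f i / 2 ^ i`
is within `1 / 2 ^ i` of `k`. -/
def powerCert (f : ℕ → ℕ) (x : ℕ × ℕ) (n : ℕ) : Bool :=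
  decide ((n.unpair.2 - 1) ^ 2 ^ n.unpair.1 ≤
      (x.2 + 1) ^ 2 ^ n.unpair.1 * x.1 ^ (f n.unpair.1 - 1)) &&
  decide ((x.2 + 1) ^ 2 ^ n.unpair.1 * x.1 ^ (f n.unpair.1 + 1) ≤
      (n.unpair.2 + 1) ^ 2 ^ n.unpair.1)

lemma computable_powerCert {f : ℕ → ℕ} (hf : Computable f) : Computable₂ (powerCert f) := by
  have hi : Computable fun q : (ℕ × ℕ) × ℕ => q.2.unpair.1 :=
    Computable.fst.comp (Computable.unpair.comp Computable.snd)
  have hy : Computable fun q : (ℕ × ℕ) × ℕ => q.2.unpair.2 :=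
    Computable.snd.comp (Computable.unpair.comp Computable.snd)
  have hp : Computable₂ ((· ^ ·) : ℕ → ℕ → ℕ) := primrec_pow.to_comp
  have hN : Computable fun q : (ℕ × ℕ) × ℕ => 2 ^ q.2.unpair.1 :=
    hp.comp (Computable.const 2) hi
  have hle : Computable₂ fun a b : ℕ => decide (a ≤ b) := Primrec.nat_le.decide.to_comp
  have hD : Computable fun q : (ℕ × ℕ) × ℕ => (q.1.2 + 1) ^ 2 ^ q.2.unpair.1 :=
    hp.comp (Computable.succ.comp (Computable.snd.comp Computable.fst)) hN
  have hr : Computable fun q : (ℕ × ℕ) × ℕ => q.1.1 := Computable.fst.comp Computable.fst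
  have hfi := hf.comp hi
  have hmul : Computable₂ ((· * ·) : ℕ → ℕ → ℕ) := Primrec.nat_mul.to_comp
  have h1 := hle.comp (hp.comp (Computable.pred.comp hy) hN)
    (hmul.comp hD (hp.comp hr (Computable.pred.comp hfi)))
  have h2 := hle.comp (hmul.comp hD (hp.comp hr (Computable.succ.comp hfi)))
    (hp.comp (Computable.succ.comp hy) hN)
  exact (Primrec.and.to_comp.comp h1 h2 : _)

section power

variable {k : ℝ} {f : ℕ → ℕ}

lemma approx_bounds
    (hf : ∀ i, |k - (f i : ℝ) / 2 ^ i| ≤ 1 / 2 ^ i) (i : ℕ) : (f i : ℝ) - 1 ≤ k * (2 ^ i : ℕ) ∧ k * (2 ^ i : ℕ) ≤ f i + 1 := by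
  have h := abs_le.1 (hf i)
  have hp : (0 : ℝ) < 2 ^ i := by positivity
  have e1 : (f i : ℝ) / 2 ^ i * 2 ^ i = f i := div_mul_cancel₀ _ hp.ne'
  have e2 : (1 : ℝ) / 2 ^ i * 2 ^ i = 1 := div_mul_cancel₀ _ hp.ne'
  push_cast
  constructor
  · nlinarith [mul_le_mul_of_nonneg_right h.1 hp.le]
  · nlinarith [mul_le_mul_of_nonneg_right h.2 hp.le]

lemma two_le_approx (hk : 2 < k)
    (hf : ∀ i, |k - (f i : ℝ) / 2 ^ i| ≤ 1 / 2 ^ i) (i : ℕ) : 2 ≤ f i := by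
  have h := (approx_bounds hf i).2
  have h1 : (1 : ℝ) ≤ (2 ^ i : ℕ) := by exact_mod_cast Nat.one_le_two_pow
  have : (1 : ℝ) < f i := by nlinarith
  exact_mod_cast this

/-- With `N = 2 ^ i`, the number `k N` lies between `f i - 1` and `f i + 1`. Hence the two integer
inequalities imply inequalities between N-th powers of `y - 1`, `(D + 1) r ^ k` and `y + 1`, and
N-th roots can be taken. -/
lemma abs_sub_le_of_powerCert (hk : 2 < k)
    (hf : ∀ i, |k - (f i : ℝ) / 2 ^ i| ≤ 1 / 2 ^ i) {x : ℕ × ℕ} {n : ℕ} (h : powerCert f x n = true) :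
    |(n.unpair.2 : ℝ) - (x.2 + 1) * (x.1 : ℝ) ^ k| ≤ 1 := by
  rw [powerCert, Bool.and_eq_true, decide_eq_true_eq, decide_eq_true_eq] at h
  obtain ⟨h1, h2⟩ := h
  set i := n.unpair.1
  set y := n.unpair.2
  have hf2 := two_le_approx hk hf i
  obtain ⟨b1, b2⟩ := approx_bounds hf i
  have hN : 2 ^ i ≠ 0 := by positivity
  have hk0 : 0 < k := by linarith
  have hX : 0 ≤ ((x.2 : ℝ) + 1) * (x.1 : ℝ) ^ k := by positivity
  rw [abs_le]
  constructor
  · have h2' : ((x.2 : ℝ) + 1) ^ 2 ^ i * (x.1 : ℝ) ^ (f i + 1) ≤ ((y : ℝ) + 1) ^ 2 ^ i := by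
      exact_mod_cast h2
    have := rpow_pow_le_pow (r := x.1) hk0 hN (b := f i + 1) (by push_cast at b2 ⊢; exact b2)
    have h3 : (((x.2 : ℝ) + 1) * (x.1 : ℝ) ^ k) ^ 2 ^ i ≤ ((y : ℝ) + 1) ^ 2 ^ i := by
      rw [mul_pow]
      exact (mul_le_mul_of_nonneg_left this (by positivity)).trans h2'
    linarith [(pow_le_pow_iff_left₀ hX (by positivity) hN).1 h3]
  · have h1' : ((y - 1 : ℕ) : ℝ) ^ 2 ^ i ≤ ((x.2 : ℝ) + 1) ^ 2 ^ i * (x.1 : ℝ) ^ (f i - 1) := by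
      exact_mod_cast h1
    have := pow_le_rpow_pow (r := x.1) (a := f i - 1) (N := 2 ^ i) (by omega)
      (by rw [Nat.cast_sub (by omega)]; simpa using b1)
    have h3 : ((y - 1 : ℕ) : ℝ) ^ 2 ^ i ≤ (((x.2 : ℝ) + 1) * (x.1 : ℝ) ^ k) ^ 2 ^ i := by
      rw [mul_pow]
      exact h1'.trans (mul_le_mul_of_nonneg_left this (by positivity))
    have h4 := (pow_le_pow_iff_left₀ (Nat.cast_nonneg _) hX hN).1 h3
    have h5 : (y : ℝ) ≤ (y - 1 : ℕ) + 1 := by exact_mod_cast (by omega : y ≤ y - 1 + 1)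
    linarith

lemma tendsto_approx
    (hf : ∀ i, |k - (f i : ℝ) / 2 ^ i| ≤ 1 / 2 ^ i) (c : ℝ) :
    Filter.Tendsto (fun i => ((f i : ℝ) + c) / 2 ^ i) Filter.atTop (nhds k) := by
  have h0 : Filter.Tendsto (fun i : ℕ => (1 : ℝ) / 2 ^ i) Filter.atTop (nhds 0) := by
    simpa using tendsto_pow_atTop_nhds_zero_of_lt_one (r := (1 / 2 : ℝ)) (by norm_num) (by norm_num)
  have h1 : Filter.Tendsto (fun i => k - (f i : ℝ) / 2 ^ i) Filter.atTop (nhds 0) :=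
    squeeze_zero_norm hf h0
  have h2 := (tendsto_const_nhds (x := k)).sub h1 |>.add (h0.const_mul c)
  simp only [sub_zero, mul_zero, add_zero] at h2
  refine h2.congr fun i => ?_
  ring

/-- The integer part `y` satisfies `y - 1 < X < y + 1` strictly. As i grows, the exponents `(f i ±
1) / 2 ^ i` tend to `k`, so both tests succeed eventually. The base 0 is treated apart, with `i = y
= 0`. -/
lemma exists_powerCert (hk : 2 < k)
    (hf : ∀ i, |k - (f i : ℝ) / 2 ^ i| ≤ 1 / 2 ^ i) (x : ℕ × ℕ) : ∃ n, powerCert f x n = true := by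
  have hk0 : 0 < k := by linarith
  rcases Nat.eq_zero_or_pos x.1 with h0 | hpos
  · refine ⟨Nat.pair 0 0, ?_⟩
    simp [powerCert, h0]
  set X : ℝ := (x.2 + 1) * (x.1 : ℝ) ^ k with hX
  set y := ⌊X⌋₊
  have hX0 : 0 ≤ X := by positivity
  have hr : (0 : ℝ) < x.1 := by exact_mod_cast hpos
  have hy1 : (y : ℝ) ≤ X := Nat.floor_le hX0
  have hy2 : X < y + 1 := Nat.lt_floor_add_one X
  have ht : ∀ c : ℝ, Filter.Tendsto (fun i => ((x.2 : ℝ) + 1) * (x.1 : ℝ) ^ (((f i : ℝ) + c) / 2 ^ i))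
      Filter.atTop (nhds X) := fun c =>
    ((Real.continuousAt_const_rpow hr.ne').tendsto.comp (tendsto_approx hf c)).const_mul _
  have e1 := (ht 1).eventually_lt_const hy2
  have e2 := (ht (-1)).eventually_const_lt (show (y : ℝ) - 1 < X by linarith)
  obtain ⟨i, h1, h2⟩ := (e1.and e2).exists
  have key : ∀ a : ℕ, (((x.2 : ℝ) + 1) * (x.1 : ℝ) ^ ((a : ℝ) / 2 ^ i)) ^ 2 ^ i =
      ((x.2 : ℝ) + 1) ^ 2 ^ i * (x.1 : ℝ) ^ a := by
    intro a
    rw [mul_pow, ← Real.rpow_natCast ((x.1 : ℝ) ^ ((a : ℝ) / 2 ^ i)), ← Real.rpow_mul hr.le]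
    push_cast
    rw [div_mul_cancel₀ _ (by positivity), Real.rpow_natCast]
  have hf2 := two_le_approx hk hf i
  refine ⟨Nat.pair i y, ?_⟩
  rw [powerCert, Bool.and_eq_true, decide_eq_true_eq, decide_eq_true_eq, Nat.unpair_pair]
  constructor
  · have h3 : ((y - 1 : ℕ) : ℝ) ≤ (x.2 + 1) * (x.1 : ℝ) ^ (((f i - 1 : ℕ) : ℝ) / 2 ^ i) := by
      rcases Nat.eq_zero_or_pos y with hy | hy
      · rw [hy]
        simp
        positivity
      · rw [Nat.cast_sub hy, Nat.cast_sub (by omega : 1 ≤ f i)]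
        simpa [sub_eq_add_neg] using h2.le
    have := pow_le_pow_left₀ (Nat.cast_nonneg _) h3 (2 ^ i)
    rw [key] at this
    exact_mod_cast this
  · have h3 : ((x.2 : ℝ) + 1) * (x.1 : ℝ) ^ (((f i + 1 : ℕ) : ℝ) / 2 ^ i) ≤ y + 1 := by
      push_cast
      exact h1.le
    have := pow_le_pow_left₀ (by positivity) h3 (2 ^ i)
    rw [key] at this
    exact_mod_cast this

end power

/-- Scaled `k`-th powers can be rounded to integers, computably if `k` is computable. -/
lemma exists_power_approx {k : ℝ} (hk : 2 < k) : ∃ pw : ℕ × ℕ → ℕ,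
    (IsComputableReal k → Computable pw) ∧
      ∀ x : ℕ × ℕ, |(pw x : ℝ) - (x.2 + 1) * (x.1 : ℝ) ^ k| ≤ 1 := by
  obtain ⟨f, hfc, hf⟩ : ∃ f : ℕ → ℕ, (IsComputableReal k → Computable f) ∧
      ∀ i, |k - (f i : ℝ) / 2 ^ i| ≤ 1 / 2 ^ i := by
    by_cases h : IsComputableReal k
    · obtain ⟨f, h1, h2⟩ := h
      exact ⟨f, fun _ => h1, h2⟩
    · refine ⟨fun i => ⌊k * 2 ^ i⌋₊, fun h' => absurd h' h, fun i => ?_⟩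
      have hp : (0 : ℝ) < 2 ^ i := by positivity
      have h1 := Nat.floor_le (show 0 ≤ k * 2 ^ i by positivity)
      have h2 := Nat.lt_floor_add_one (k * 2 ^ i)
      have e : k - (⌊k * 2 ^ i⌋₊ : ℝ) / 2 ^ i = (k * 2 ^ i - ⌊k * 2 ^ i⌋₊) / 2 ^ i := by
        field_simp
      rw [e, abs_of_nonneg (div_nonneg (by linarith) hp.le)]
      gcongr
      linarith
  have hex := exists_powerCert hk hf
  refine ⟨fun x => (Nat.find (hex x)).unpair.2, fun h => ?_, fun x => ?_⟩
  · exact Computable.snd.comp (Computable.unpair.comp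
      (computable_find (computable_powerCert (hfc h)) hex))
  · exact abs_sub_le_of_powerCert hk hf (Nat.find_spec (hex x))

/-- Integers of order `m ^ (1 - 1 / k)`, computable if `k` is computable. -/
lemma exists_size_approx {k : ℝ} (hk : 2 < k) {pw : ℕ × ℕ → ℕ}
    (hpw : ∀ x : ℕ × ℕ, |(pw x : ℝ) - (x.2 + 1) * (x.1 : ℝ) ^ k| ≤ 1) :
    ∃ sz : ℕ → ℕ, (Computable pw → Computable sz) ∧ ∀ m : ℕ, 1 ≤ m →
      (m : ℝ) ^ (1 - 1 / k) ≤ sz m ∧ (sz m : ℝ) ≤ 12 * (m : ℝ) ^ (1 - 1 / k) := by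
  have hk0 : 0 < k := by linarith
  have hpw' : ∀ s : ℕ, |(pw (s, 0) : ℝ) - (s : ℝ) ^ k| ≤ 1 := fun s => by simpa using hpw (s, 0)
  -- With `M = m + 1`, the least s with roughly `s ^ k ≥ M ^ (k - 1)`. The extra `M + 1` compensates
  -- the rounding errors of both powers, and `M > 0` keeps the search total at `m = 0`.
  have hex : ∀ m : ℕ, ∃ s, decide (pw (m + 1, 0) + (m + 1) + 1 ≤ pw (s, 0) * (m + 1)) = true := by
    intro m
    refine ⟨pw (m + 1, 0) + (m + 1) + 2, ?_⟩
    rw [decide_eq_true_eq]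
    set s := pw (m + 1, 0) + (m + 1) + 2
    have h1 : (s : ℝ) ≤ (s : ℝ) ^ k := by
      have : (1 : ℝ) ≤ s := by exact_mod_cast (by omega : 1 ≤ s)
      simpa using Real.rpow_le_rpow_of_exponent_le this (by linarith : (1 : ℝ) ≤ k)
    have h2 := (abs_le.1 (hpw' s)).1
    have h3 : s ≤ pw (s, 0) + 1 := by
      have : (s : ℝ) ≤ pw (s, 0) + 1 := by linarith
      exact_mod_cast this
    exact (by omega : pw (m + 1, 0) + (m + 1) + 1 ≤ pw (s, 0)).trans
      (Nat.le_mul_of_pos_right _ (Nat.succ_pos m))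
  refine ⟨fun m => Nat.find (hex m), fun hc => ?_, fun m hm => ?_⟩
  · refine computable_find ?_ hex
    have hle : Computable₂ fun a b : ℕ => decide (a ≤ b) := Primrec.nat_le.decide.to_comp
    have hadd : Computable₂ ((· + ·) : ℕ → ℕ → ℕ) := Primrec.nat_add.to_comp
    have hmul : Computable₂ ((· * ·) : ℕ → ℕ → ℕ) := Primrec.nat_mul.to_comp
    have hm : Computable fun q : ℕ × ℕ => q.1 + 1 := Computable.succ.comp Computable.fst
    exact hle.comp
      (Computable.succ.comp (hadd.comp (hc.comp (Computable.pair hm (Computable.const 0))) hm))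
      (hmul.comp (hc.comp (Computable.pair Computable.snd (Computable.const 0))) hm)
  · have hspec := Nat.find_spec (hex m)
    have hmin := fun {j} => Nat.find_min (hex m) (m := j)
    set s := Nat.find (hex m) with hs
    change _ ≤ (s : ℝ) ∧ (s : ℝ) ≤ _
    rw [decide_eq_true_eq] at hspec
    set M : ℝ := m + 1 with hM
    have hm1 : (1 : ℝ) ≤ m := by exact_mod_cast hm
    have hM1 : 1 ≤ M := by linarith
    have hM0 : 0 < M := by linarith
    have hpM := abs_le.1 (hpw' (m + 1))
    push_cast at hpM
    have hMk : M ^ k = M ^ (k - 1) * M := by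
      rw [← Real.rpow_add_one hM0.ne', sub_add_cancel]
    have hMp : M ^ (k - 1) = (M ^ (1 - 1 / k)) ^ k := by
      rw [← Real.rpow_mul hM0.le]
      congr 1
      field_simp
    have hMp1 : 1 ≤ M ^ (1 - 1 / k) := by
      refine Real.one_le_rpow hM1 ?_
      rw [sub_nonneg, div_le_one hk0]
      linarith
    constructor
    · have h1 : (pw (m + 1, 0) : ℝ) + M + 1 ≤ pw (s, 0) * M := by
        rw [hM]; exact_mod_cast hspec
      have h2 := abs_le.1 (hpw' s)
      have h3 : M ^ (k - 1) ≤ (s : ℝ) ^ k := by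
        have : M ^ (k - 1) * M ≤ (s : ℝ) ^ k * M := by nlinarith [hpM.1]
        exact le_of_mul_le_mul_right this hM0
      rw [hMp] at h3
      have h4 := (Real.rpow_le_rpow_iff (by positivity) (Nat.cast_nonneg s) hk0).1 h3
      refine le_trans ?_ h4
      refine Real.rpow_le_rpow (by linarith) (by linarith) ?_
      rw [sub_nonneg, div_le_one hk0]
      linarith
    · have h6 : (s : ℝ) ≤ 6 * M ^ (1 - 1 / k) := by
        rcases Nat.eq_zero_or_pos s with h0 | hpos
        · rw [h0]; simp; positivity
        · have h1 := hmin (j := s - 1) (by omega)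
          rw [decide_eq_true_eq, not_le] at h1
          have h1 : (pw (s - 1, 0) : ℝ) * M < pw (m + 1, 0) + M + 1 := by
            rw [hM]; exact_mod_cast h1
          have h2 := abs_le.1 (hpw' (s - 1))
          have h3 : ((s - 1 : ℕ) : ℝ) ^ k ≤ 5 * M ^ (k - 1) := by
            have h7 : 1 ≤ M ^ (k - 1) := Real.one_le_rpow hM1 (by linarith)
            -- Minimality gives the upper bound `M ^ k + 2 M + 2`, and both M and 1 are at most `M ^
            -- (k - 1) * M`.
            have : ((s - 1 : ℕ) : ℝ) ^ k * M ≤ 5 * M ^ (k - 1) * M := by nlinarith [hpM.2]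
            exact le_of_mul_le_mul_right this hM0
          have h5 : (5 : ℝ) ≤ 5 ^ k := by
            simpa using Real.rpow_le_rpow_of_exponent_le (by norm_num : (1 : ℝ) ≤ 5)
              (by linarith : (1 : ℝ) ≤ k)
          have h4 : ((s - 1 : ℕ) : ℝ) ^ k ≤ (5 * M ^ (1 - 1 / k)) ^ k := by
            rw [Real.mul_rpow (by norm_num) (by positivity), ← hMp]
            exact h3.trans (mul_le_mul_of_nonneg_right h5 (by positivity))
          have h8 := (Real.rpow_le_rpow_iff (Nat.cast_nonneg _) (by positivity) hk0).1 h4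
          have h9 : (s : ℝ) = (s - 1 : ℕ) + 1 := by exact_mod_cast (by omega : s = s - 1 + 1)
          rw [h9]
          linarith
      have h7 : M ^ (1 - 1 / k) ≤ 2 * (m : ℝ) ^ (1 - 1 / k) := by
        have e0 : 0 ≤ 1 - 1 / k := by
          rw [sub_nonneg, div_le_one hk0]
          linarith
        calc M ^ (1 - 1 / k) ≤ (2 * (m : ℝ)) ^ (1 - 1 / k) :=
              Real.rpow_le_rpow hM0.le (by linarith) e0
          _ = 2 ^ (1 - 1 / k) * (m : ℝ) ^ (1 - 1 / k) :=
              Real.mul_rpow (by norm_num) (by linarith)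
          _ ≤ 2 * (m : ℝ) ^ (1 - 1 / k) := by
              refine mul_le_mul_of_nonneg_right ?_ (by positivity)
              have : 0 < 1 / k := by positivity
              simpa using Real.rpow_le_rpow_of_exponent_le (by norm_num : (1 : ℝ) ≤ 2)
                (by linarith : 1 - 1 / k ≤ 1)
      linarith

/-! Frequency moments. -/

/-- The increment of the `k`-th power. -/
noncomputable def powInc (k : ℝ) (r : ℕ) : ℝ := (r : ℝ) ^ k - ((r - 1 : ℕ) : ℝ) ^ k

section moments

variable {k : ℝ} {m : ℕ}

lemma freqMoment_nil (hk : 0 < k) : freqMoment k m [] = 0 := by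
  simp [freqMoment, Real.zero_rpow hk.ne']

/-- The telescoping step: prepending an element changes one count by one, and its rank from the end
is the new count. -/
lemma freqMoment_cons {x : ℕ} (w : List ℕ) (hx : 1 ≤ x ∧ x ≤ m) :
    freqMoment k m (x :: w) = freqMoment k m w + powInc k (w.count x + 1) := by
  have hm : x ∈ Finset.Icc 1 m := Finset.mem_Icc.2 hx
  rw [freqMoment, freqMoment, ← Finset.add_sum_erase _ _ hm, ← Finset.add_sum_erase _ _ hm]
  have : ∀ i ∈ (Finset.Icc 1 m).erase x, (((x :: w).count i : ℕ) : ℝ) ^ k = (w.count i : ℝ) ^ k :=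
    fun i hi => by rw [List.count_cons_of_ne (Finset.ne_of_mem_erase hi).symm]
  rw [Finset.sum_congr rfl this, List.count_cons_self, powInc, Nat.add_sub_cancel]
  ring

lemma count_rpow_le_freqMoment {x : ℕ} (w : List ℕ) (hx : 1 ≤ x ∧ x ≤ m) :
    (w.count x : ℝ) ^ k ≤ freqMoment k m w :=
  Finset.single_le_sum (f := fun i => (w.count i : ℝ) ^ k) (fun _ _ => by positivity)
    (Finset.mem_Icc.2 hx)

lemma freqMoment_nonneg (w : List ℕ) : 0 ≤ freqMoment k m w :=
  Finset.sum_nonneg fun _ _ => by positivity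

/-- Superadditivity of the k-th power. It turns a bounded absolute rounding error into a relative
one. -/
lemma one_le_powInc (hk : 1 ≤ k) {r : ℕ} (hr : 1 ≤ r) : 1 ≤ powInc k r := by
  have h := Real.add_rpow_le_rpow_add (p := k) (Nat.cast_nonneg (r - 1)) zero_le_one hk
  rw [Real.one_rpow] at h
  have e : ((r - 1 : ℕ) : ℝ) + 1 = r := by exact_mod_cast (by omega : r - 1 + 1 = r)
  rw [e] at h
  rw [powInc]
  linarith

/-- Bernoulli's inequality at `-1 / r`. -/
lemma powInc_le (hk : 1 ≤ k) {r : ℕ} (hr : 1 ≤ r) : powInc k r ≤ k * (r : ℝ) ^ (k - 1) := by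
  have hr0 : (0 : ℝ) < r := by exact_mod_cast hr
  have hr1 : (1 : ℝ) ≤ r := by exact_mod_cast hr
  have hinv : (1 : ℝ) / r ≤ 1 := by rw [div_le_one hr0]; exact hr1
  have h := one_add_mul_self_le_rpow_one_add (s := -(1 / (r : ℝ))) (by linarith) hk
  have e : ((r - 1 : ℕ) : ℝ) = r * (1 + -(1 / (r : ℝ))) := by
    rw [Nat.cast_sub hr]
    field_simp
    simp
    ring
  have e2 : (r : ℝ) ^ k = (r : ℝ) ^ (k - 1) * r := by
    rw [← Real.rpow_add_one hr0.ne', sub_add_cancel]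
  rw [powInc, e, Real.mul_rpow hr0.le (by linarith)]
  have h2 := mul_le_mul_of_nonneg_left h (Real.rpow_nonneg hr0.le k)
  have e3 : (r : ℝ) ^ k * (1 + k * -(1 / (r : ℝ))) = (r : ℝ) ^ k - k * (r : ℝ) ^ (k - 1) := by
    rw [e2]
    field_simp
    ring
  linarith

/-- The power mean inequality for the m counts. -/
lemma length_le_freqMoment (hk : 1 ≤ k) (w : List ℕ) (hw : ∀ x ∈ w, 1 ≤ x ∧ x ≤ m) :
    (w.length : ℝ) ≤ (m : ℝ) ^ (1 - 1 / k) * freqMoment k m w ^ (1 / k) := by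
  have hk0 : 0 < k := by linarith
  have h1 : (w.length : ℝ) = ∑ i ∈ Finset.Icc 1 m, (w.count i : ℝ) := by
    have := List.sum_toFinset_count_eq_length w
    have h2 : ∑ i ∈ Finset.Icc 1 m, w.count i = w.length := by
      rw [← this]
      refine (Finset.sum_subset (fun x hx => ?_) fun x _ hx => ?_).symm
      · exact Finset.mem_Icc.2 (hw x (List.mem_toFinset.1 hx))
      · exact List.count_eq_zero.2 fun h => hx (List.mem_toFinset.2 h)
    exact_mod_cast h2.symm
  have h2 := Real.rpow_sum_le_const_mul_sum_rpow_of_nonneg (Finset.Icc 1 m) hk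
    (f := fun i => (w.count i : ℝ)) fun _ _ => Nat.cast_nonneg _
  rw [← h1, Nat.card_Icc, Nat.add_sub_cancel, ← freqMoment] at h2
  have h3 := Real.rpow_le_rpow (by positivity) h2 (show 0 ≤ 1 / k by positivity)
  rw [← Real.rpow_mul (Nat.cast_nonneg _), mul_one_div_cancel hk0.ne', Real.rpow_one,
    Real.mul_rpow (by positivity) (freqMoment_nonneg w), ← Real.rpow_mul (Nat.cast_nonneg _)] at h3
  refine h3.trans (le_of_eq ?_)
  congr 2
  field_simp

/-! ### Bias and second moment for rounded increments. -/

variable {G : ℕ → ℕ} {Δ ε : ℝ}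

lemma abs_rankSum_sub_le (hk : 0 < k)
    (hG : ∀ r : ℕ, 1 ≤ r → |(G r : ℝ) - Δ * powInc k r| ≤ ε * powInc k r) (w : List ℕ)
    (hw : ∀ x ∈ w, 1 ≤ x ∧ x ≤ m) :
    |(rankSum G w : ℝ) - Δ * freqMoment k m w| ≤ ε * freqMoment k m w := by
  induction w with
  | nil => simp [rankSum, freqMoment_nil hk]
  | cons x w ih =>
    have ih := ih fun y hy => hw y (by simp [hy])
    have h := hG (w.count x + 1) (by omega)
    rw [freqMoment_cons w (hw x (by simp)), rankSum]
    push_cast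
    rw [abs_le] at *
    constructor <;> nlinarith

/-- One factor of `G r ^ 2` is bounded uniformly, through `k r^(k-1) ≤ k B^(1-1/k)`; the other
telescopes to the moment. The bound B is kept fixed while the list shrinks in the induction. -/
lemma rankSum_sq_le (hk : 1 ≤ k)
    (hG : ∀ r : ℕ, 1 ≤ r → (G r : ℝ) ≤ 2 * Δ * powInc k r) (B : ℝ) (w : List ℕ)
    (hw : ∀ x ∈ w, 1 ≤ x ∧ x ≤ m) (hB : freqMoment k m w ≤ B) :
    ((rankSum (fun r => G r ^ 2) w : ℕ) : ℝ) ≤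
      4 * Δ ^ 2 * k * B ^ (1 - 1 / k) * freqMoment k m w := by
  have hk0 : 0 < k := by linarith
  induction w with
  | nil => simp [rankSum, freqMoment_nil hk0]
  | cons x w ih =>
    have hx := hw x (by simp)
    have hr1 : 1 ≤ w.count x + 1 := by omega
    have hinc := one_le_powInc hk hr1
    have hcount := count_rpow_le_freqMoment (k := k) (x :: w) hx
    have hcons := freqMoment_cons (k := k) w hx
    have ih := ih (fun y hy => hw y (by simp [hy])) (by linarith)
    rw [List.count_cons_self] at hcount
    have hg := powInc_le hk hr1
    have hGr := hG _ hr1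
    rw [hcons, rankSum]
    generalize w.count x + 1 = r at *
    have hB0 : 0 ≤ B := (freqMoment_nonneg _).trans hB
    have hpow : (r : ℝ) ^ (k - 1) ≤ B ^ (1 - 1 / k) := by
      have e : (r : ℝ) ^ (k - 1) = ((r : ℝ) ^ k) ^ (1 - 1 / k) := by
        rw [← Real.rpow_mul (Nat.cast_nonneg _)]
        congr 1
        field_simp
      rw [e]
      refine Real.rpow_le_rpow (by positivity) (hcount.trans hB) ?_
      rw [sub_nonneg, div_le_one hk0]
      exact hk
    have h1 : (G r : ℝ) ^ 2 ≤ 4 * Δ ^ 2 * k * B ^ (1 - 1 / k) * powInc k r := by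
      calc (G r : ℝ) ^ 2 ≤ (2 * Δ * powInc k r) ^ 2 := pow_le_pow_left₀ (Nat.cast_nonneg _) hGr 2
        _ = 4 * Δ ^ 2 * powInc k r * powInc k r := by ring
        _ ≤ 4 * Δ ^ 2 * (k * B ^ (1 - 1 / k)) * powInc k r := by
            gcongr
            exact hg.trans (mul_le_mul_of_nonneg_left hpow hk0.le)
        _ = _ := by ring
    push_cast
    rw [mul_add]
    linarith

/-- The variance bound for the sampling estimator. -/
lemma length_mul_rankSum_sq_le (hk : 1 ≤ k)
    (hG : ∀ r : ℕ, 1 ≤ r → (G r : ℝ) ≤ 2 * Δ * powInc k r) (w : List ℕ)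
    (hw : ∀ x ∈ w, 1 ≤ x ∧ x ≤ m) :
    ((2 * w.length * rankSum (fun r => G r ^ 2) w : ℕ) : ℝ) ≤
      8 * k * (m : ℝ) ^ (1 - 1 / k) * (Δ * freqMoment k m w) ^ 2 := by
  have hk0 : 0 < k := by linarith
  have h1 := length_le_freqMoment hk w hw
  have h2 := rankSum_sq_le hk hG _ w hw le_rfl
  set F := freqMoment k m w
  have hF : 0 ≤ F := freqMoment_nonneg w
  have e : F ^ (1 / k) * F ^ (1 - 1 / k) = F := by
    rw [← Real.rpow_add' hF (by simp), add_sub_cancel, Real.rpow_one]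
  push_cast
  calc 2 * (w.length : ℝ) * (rankSum (fun r => G r ^ 2) w : ℕ)
      ≤ 2 * ((m : ℝ) ^ (1 - 1 / k) * F ^ (1 / k)) *
          (4 * Δ ^ 2 * k * F ^ (1 - 1 / k) * F) := by gcongr
    _ = 8 * k * (m : ℝ) ^ (1 - 1 / k) * (Δ ^ 2 * ((F ^ (1 / k) * F ^ (1 - 1 / k)) * F)) := by ring
    _ = _ := by rw [e]; ring

end moments

end WindowSketch

namespace WindowSketch

/-! Computability of the ingredients. -/

section computability

variable {α β σ : Type} [Primcodable α] [Primcodable β] [Primcodable σ]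

/-- The fold is a primitive recursion over the number of entries read, with lookup by index. -/
lemma computable_list_foldl {f : α → List β} {g : α → σ} {h : α → σ × β → σ} (hf : Computable f)
    (hg : Computable g) (hh : Computable₂ h) :
    Computable fun a => (f a).foldl (fun s b => h a (s, b)) (g a) := by
  have hstep : Computable₂ fun (a : α) (q : ℕ × σ) =>
      (Option.casesOn (f a)[q.1]? q.2 fun b => h a (q.2, b) : σ) := by
    refine Computable.option_casesOn (o := fun x : α × ℕ × σ => (f x.1)[x.2.1]?)
      (f := fun x => x.2.2) (g := fun x b => h x.1 (x.2.2, b))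
      (Computable.list_getElem?.comp (hf.comp Computable.fst)
        (Computable.fst.comp Computable.snd))
      (Computable.snd.comp Computable.snd) ?_
    exact hh.comp (Computable.fst.comp Computable.fst)
      (Computable.pair (Computable.snd.comp (Computable.snd.comp Computable.fst)) Computable.snd)
  refine (Computable.nat_rec (Computable.list_length.comp hf) hg hstep).of_eq fun a => ?_
  have key : ∀ (F : ℕ → σ), F 0 = g a →
      (∀ i, F (i + 1) = Option.casesOn (f a)[i]? (F i) fun b => h a (F i, b)) →
      ∀ n, F n = ((f a).take n).foldl (fun s b => h a (s, b)) (g a) := by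
    intro F h0 hs n
    induction n with
    | zero => simpa using h0
    | succ n ih =>
      rw [List.take_add_one, List.foldl_append, ← ih, hs]
      cases (f a)[n]? <;> rfl
  have := key (fun n => Nat.rec (g a)
    (fun i s => (Option.casesOn (f a)[i]? s fun b => h a (s, b) : σ)) n) rfl (fun _ => rfl)
    (f a).length
  rwa [List.take_length] at this

lemma computable_list_map {f : α → List β} {g : α → β → σ} (hf : Computable f)
    (hg : Computable₂ g) : Computable fun a => (f a).map (g a) := by
  refine (computable_list_foldl (h := fun a (q : List σ × β) => q.1 ++ [g a q.2]) hf
    (Computable.const []) ?_).of_eq fun a => ?_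
  · exact Computable.list_concat.comp (Computable.fst.comp Computable.snd)
      (hg.comp Computable.fst (Computable.snd.comp Computable.snd))
  · have key : ∀ (l : List β) (r : List σ),
        l.foldl (fun s b => s ++ [g a b]) r = r ++ l.map (g a) := by
      intro l
      induction l with
      | nil => simp
      | cons b l ih => intro r; simp [ih]
    simpa using key (f a) []

lemma primrec_list_sum : Primrec (List.sum : List ℕ → ℕ) :=
  (Primrec.list_foldr (h := fun _ (q : ℕ × ℕ) => q.1 + q.2) Primrec.id (Primrec.const 0)
    (Primrec.nat_add.comp (Primrec.fst.comp Primrec.snd)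
      (Primrec.snd.comp Primrec.snd))).of_eq fun l => by
    induction l with
    | nil => rfl
    | cons a l ih => simp_all

/-- Course-of-values recursion: the digits of `n` are its parity followed by the digits of its half.
-/
lemma primrec_bits : Primrec Nat.bits := by
  have hg : Primrec₂ fun (_ : Unit) (L : List (List Bool)) =>
      if L.length = 0 then some [] else
        (L[Nat.div2 L.length]?).map (List.cons (Nat.bodd L.length)) := by
    have hl : Primrec fun q : Unit × List (List Bool) => q.2.length :=
      Primrec.list_length.comp Primrec.snd
    refine Primrec.ite (PrimrecRel.comp Primrec.eq hl (Primrec.const 0)) (Primrec.const _) ?_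
    refine Primrec.option_map (Primrec.list_getElem?.comp Primrec.snd (Primrec.nat_div2.comp hl)) ?_
    exact Primrec.list_cons.comp (Primrec.nat_bodd.comp (hl.comp Primrec.fst)) Primrec.snd
  have := Primrec.nat_strong_rec (fun (_ : Unit) n => Nat.bits n) hg fun _ n => by
    rw [List.length_map, List.length_range]
    split_ifs with h
    · simp [h]
    · have hlt : Nat.div2 n < n := by rw [Nat.div2_val]; omega
      rw [List.getElem?_map, List.getElem?_range hlt]
      have hb : Nat.bit (Nat.bodd n) (Nat.div2 n) = n := Nat.bit_bodd_div2 n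
      have := Nat.bits_append_bit (Nat.div2 n) (Nat.bodd n) fun h0 => by
        rw [h0] at hb
        by_contra hne
        rw [Bool.not_eq_true] at hne
        rw [hne] at hb
        exact h (by simpa using hb.symm)
      rw [hb] at this
      simp [this]
  exact this.comp (Primrec.const ()) Primrec.id

lemma primrec_encodeNum : Primrec encodeNum := by
  refine Primrec.list_append.comp (Primrec.list_flatMap primrec_bits ?_) (Primrec.const _)
  exact Primrec.list_cons.comp (Primrec.const true)
    (Primrec.list_cons.comp Primrec.snd (Primrec.const []))

lemma primrec_encodeState : Primrec encodeState := by
  have h : Primrec encodeBuckets :=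
    Primrec.list_append.comp (Primrec.list_flatMap Primrec.id
      (primrec_encodeNum.comp (Primrec.encode.comp Primrec.snd)).to₂) (Primrec.const _)
  exact Primrec.list_flatMap Primrec.id (h.comp Primrec.snd).to₂

lemma primrec_decodeState : Primrec decodeState := by
  have hstep : Primrec₂ fun (_ : List Bool) (q : Bool × (List (List ℕ) × Option Bool)) =>
      decodeStep q.1 q.2 := by
    have hb : Primrec fun x : (List Bool × Bool × (List (List ℕ) × Option Bool)) × Bool =>
        x.1.2.1 := Primrec.fst.comp (Primrec.snd.comp Primrec.fst)
    have hst : Primrec fun x : (List Bool × Bool × (List (List ℕ) × Option Bool)) × Bool =>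
        x.1.2.2.1 := Primrec.fst.comp (Primrec.snd.comp (Primrec.snd.comp Primrec.fst))
    have hadd : Primrec₂ fun (c : Bool) (n : ℕ) => 2 * n + c.toNat :=
      Primrec.nat_add.comp (Primrec.nat_double.comp Primrec.snd)
        ((Primrec.dom_finite Bool.toNat).comp Primrec.fst)
    have h1 : Primrec₂ fun (c : Bool) (l : List ℕ) => l.modifyHead fun n => 2 * n + c.toNat :=
      (Primrec.list_modifyHead' hadd).swap
    have h2 := (Primrec.list_modifyHead' h1).comp hst Primrec.snd
    have h3 : Primrec₂ fun (_ : Unit) (l : List ℕ) => 0 :: l :=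
      Primrec.list_cons.comp (Primrec.const 0) Primrec.snd
    have h4 := (Primrec.list_modifyHead' h3).comp hst (Primrec.const ())
    have h5 := Primrec.list_cons.comp (Primrec.const ([] : List ℕ)) hst
    have h6 := Primrec.pair (Primrec.ite (PrimrecRel.comp Primrec.eq hb (Primrec.const true)) h2
      (Primrec.ite (PrimrecRel.comp Primrec.eq Primrec.snd (Primrec.const true)) h4 h5))
      (Primrec.const (none : Option Bool))
    refine (Primrec.option_casesOn (o := fun x : List Bool × Bool × (List (List ℕ) × Option Bool) =>
      x.2.2.2) (f := fun x => (x.2.2.1, some x.2.1))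
      (Primrec.snd.comp (Primrec.snd.comp Primrec.snd)) ?_ h6.to₂).of_eq fun x => ?_
    · exact Primrec.pair (Primrec.fst.comp (Primrec.snd.comp Primrec.snd))
        (Primrec.option_some.comp (Primrec.fst.comp Primrec.snd))
    · obtain ⟨_, b, st, _ | c⟩ := x <;> rfl
  have hdec : Primrec decodeBucket :=
    Primrec.option_getD.comp Primrec.decode (Primrec.const default)
  have hfold := Primrec.list_foldr Primrec.id (Primrec.const (([] : List (List ℕ)), none)) hstep
  refine Primrec.list_map (Primrec.fst.comp hfold) ?_
  exact Primrec.list_map Primrec.snd (hdec.comp Primrec.snd).to₂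

/-! ### Primitive recursiveness of the bucket operations. -/

section merge

lemma primrec_total : Primrec total :=
  primrec_list_sum.comp (Primrec.list_map Primrec.id (Primrec.fst.comp Primrec.snd).to₂)

/-- The condition under which the two first buckets of a list may be merged. -/
lemma primrec_merge_cond {b b' : α → Bucket} {l : α → List Bucket} (hb : Primrec b)
    (hb' : Primrec b') (hl : Primrec l) :
    PrimrecPred fun x => (b x).1 + (b' x).1 ≤ total (l x) + 1 :=
  PrimrecRel.comp Primrec.nat_le
    (Primrec.nat_add.comp (Primrec.fst.comp hb) (Primrec.fst.comp hb'))
    (Primrec.succ.comp (primrec_total.comp hl))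

lemma primrec_headRange : Primrec₂ headRange := by
  have hb : Primrec fun x : (Bucket × List Bucket) × Bucket × List Bucket => x.1.1 :=
    Primrec.fst.comp Primrec.fst
  have hb' : Primrec fun x : (Bucket × List Bucket) × Bucket × List Bucket => x.2.1 :=
    Primrec.fst.comp Primrec.snd
  refine (Primrec.list_casesOn (f := fun x : Bucket × List Bucket => x.2) Primrec.snd
    (Primrec.const 0) (Primrec.ite (primrec_merge_cond hb hb' (Primrec.snd.comp Primrec.snd))
      (Primrec.nat_add.comp (Primrec.fst.comp hb) (Primrec.fst.comp hb'))
      (Primrec.const 0)).to₂).of_eq fun x => ?_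
  obtain ⟨b, _ | ⟨b', l⟩⟩ := x <;> rfl

lemma primrec_mergeRange : Primrec mergeRange := by
  have hIH : Primrec fun x : List Bucket × Bucket × List Bucket × ℕ => x.2.2.2 :=
    Primrec.snd.comp (Primrec.snd.comp Primrec.snd)
  refine (Primrec.list_rec (h := fun (_ : List Bucket) (q : Bucket × List Bucket × ℕ) =>
    if q.2.2 = 0 then headRange q.1 q.2.1 else q.2.2) Primrec.id (Primrec.const 0)
    (Primrec.ite (PrimrecRel.comp Primrec.eq hIH (Primrec.const 0))
      (primrec_headRange.comp (Primrec.fst.comp Primrec.snd)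
        (Primrec.fst.comp (Primrec.snd.comp Primrec.snd))) hIH)).of_eq fun l => ?_
  induction l with
  | nil => rfl
  | cons b l ih =>
    simp only [id] at ih ⊢
    rw [mergeRange, ← ih]

lemma primrec_headMerge : Primrec fun x : ℕ × Bucket × List Bucket =>
    headMerge x.1 x.2.1 x.2.2 := by
  have hu : Primrec fun x : (ℕ × Bucket × List Bucket) × Bucket × List Bucket => x.1.1 :=
    Primrec.fst.comp Primrec.fst
  have hb : Primrec fun x : (ℕ × Bucket × List Bucket) × Bucket × List Bucket => x.1.2.1 :=
    Primrec.fst.comp (Primrec.snd.comp Primrec.fst)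
  have hb' : Primrec fun x : (ℕ × Bucket × List Bucket) × Bucket × List Bucket => x.2.1 :=
    Primrec.fst.comp Primrec.snd
  have hl : Primrec fun x : (ℕ × Bucket × List Bucket) × Bucket × List Bucket => x.2.2 :=
    Primrec.snd.comp Primrec.snd
  have hs : Primrec fun x : (ℕ × Bucket × List Bucket) × Bucket × List Bucket =>
      if x.1.1 < x.1.2.1.1 then x.1.2.1.2.2 else x.2.1.2.2 :=
    Primrec.ite (PrimrecRel.comp Primrec.nat_lt hu (Primrec.fst.comp hb))
      (Primrec.snd.comp (Primrec.snd.comp hb)) (Primrec.snd.comp (Primrec.snd.comp hb'))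
  have hm : Primrec fun x : (ℕ × Bucket × List Bucket) × Bucket × List Bucket =>
      mergeBuckets x.1.1 x.1.2.1 x.2.1 :=
    Primrec.pair (Primrec.nat_add.comp (Primrec.fst.comp hb) (Primrec.fst.comp hb'))
      (Primrec.pair (Primrec.fst.comp (Primrec.snd.comp hb')) hs)
  refine (Primrec.list_casesOn (f := fun x : ℕ × Bucket × List Bucket => x.2.2)
    (Primrec.snd.comp Primrec.snd)
    (Primrec.list_cons.comp (Primrec.fst.comp Primrec.snd) (Primrec.const []))
    (Primrec.ite (primrec_merge_cond hb hb' hl) (Primrec.list_cons.comp hm hl)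
      (Primrec.list_cons.comp hb (Primrec.list_cons.comp hb' hl))).to₂).of_eq fun x => ?_
  obtain ⟨u, b, _ | ⟨b', l⟩⟩ := x <;> rfl

lemma primrec_mergeNewest : Primrec₂ mergeNewest := by
  have hb : Primrec fun x : (ℕ × List Bucket) × Bucket × List Bucket × List Bucket => x.2.1 :=
    Primrec.fst.comp Primrec.snd
  have hl : Primrec fun x : (ℕ × List Bucket) × Bucket × List Bucket × List Bucket => x.2.2.1 :=
    Primrec.fst.comp (Primrec.snd.comp Primrec.snd)
  have hIH : Primrec fun x : (ℕ × List Bucket) × Bucket × List Bucket × List Bucket => x.2.2.2 :=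
    Primrec.snd.comp (Primrec.snd.comp Primrec.snd)
  refine (Primrec.list_rec
    (h := fun (a : ℕ × List Bucket) (q : Bucket × List Bucket × List Bucket) =>
      if mergeRange q.2.1 = 0 then headMerge a.1 q.1 q.2.1 else q.1 :: q.2.2)
    (f := fun a : ℕ × List Bucket => a.2) Primrec.snd (Primrec.const [])
    (Primrec.ite (PrimrecRel.comp Primrec.eq (primrec_mergeRange.comp hl) (Primrec.const 0))
      (primrec_headMerge.comp
        (Primrec.pair (Primrec.fst.comp Primrec.fst) (Primrec.pair hb hl)))
      (Primrec.list_cons.comp hb hIH))).of_eq fun x => ?_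
  obtain ⟨u, l⟩ := x
  induction l with
  | nil => rfl
  | cons b l ih =>
    simp only at ih ⊢
    rw [mergeNewest, ← ih]

lemma primrec_insertNew : Primrec₂ insertNew := by
  have he : Primrec fun x : (ℕ × List Bucket) × Bucket => x.1.1 := Primrec.fst.comp Primrec.fst
  have hs : Primrec fun x : (ℕ × List Bucket) × Bucket => x.2.2.2 :=
    Primrec.snd.comp (Primrec.snd.comp Primrec.snd)
  have hhit : Primrec fun x : (ℕ × List Bucket) × Bucket => hitSample x.1.1 x.2.2.2 :=
    Primrec.ite (PrimrecRel.comp Primrec.eq (Primrec.fst.comp hs) he)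
      (Primrec.pair (Primrec.fst.comp hs) (Primrec.pair (Primrec.fst.comp (Primrec.snd.comp hs))
        (Primrec.succ.comp (Primrec.snd.comp (Primrec.snd.comp hs))))) hs
  refine Primrec.list_append.comp (Primrec.list_map Primrec.snd
    (Primrec.pair (Primrec.fst.comp Primrec.snd)
      (Primrec.pair (Primrec.fst.comp (Primrec.snd.comp Primrec.snd)) hhit)).to₂) ?_
  exact Primrec.list_cons.comp (Primrec.pair (Primrec.const 1) (Primrec.pair (Primrec.const 0)
    (Primrec.pair Primrec.fst (Primrec.const (0, 1))))) (Primrec.const [])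

lemma primrec_tick : Primrec₂ tick := by
  have ht : Primrec fun x : (ℕ × List Bucket) × Bucket => x.1.1 := Primrec.fst.comp Primrec.fst
  have hs : Primrec fun x : (ℕ × List Bucket) × Bucket => x.2.2.2 :=
    Primrec.snd.comp (Primrec.snd.comp Primrec.snd)
  have ha : Primrec fun x : (ℕ × List Bucket) × Bucket => x.2.2.1 + 1 :=
    Primrec.succ.comp (Primrec.fst.comp (Primrec.snd.comp Primrec.snd))
  have hsa : Primrec fun x : (ℕ × List Bucket) × Bucket => x.2.2.2.2.1 + 1 :=
    Primrec.succ.comp (Primrec.fst.comp (Primrec.snd.comp hs))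
  have hage : Primrec fun x : (ℕ × List Bucket) × Bucket => ageSample x.1.1 x.2.2.2 :=
    Primrec.ite (PrimrecRel.comp Primrec.nat_lt hsa ht)
      (Primrec.pair (Primrec.fst.comp hs)
        (Primrec.pair hsa (Primrec.snd.comp (Primrec.snd.comp hs))))
      (Primrec.pair (Primrec.const 0) (Primrec.pair ht (Primrec.const 0)))
  exact Primrec.listFilterMap Primrec.snd (Primrec.ite (PrimrecRel.comp Primrec.nat_lt ha ht)
    (Primrec.option_some.comp (Primrec.pair (Primrec.fst.comp Primrec.snd)
      (Primrec.pair ha hage))) (Primrec.const none)).to₂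

lemma primrec_timeRange : Primrec fun x : (ℕ × ℕ × ℕ × ℕ) × List Bucket × Option ℕ =>
    timeRange x.1 x.2.1 x.2.2 := by
  refine (Primrec.option_casesOn (o := fun x : (ℕ × ℕ × ℕ × ℕ) × List Bucket × Option ℕ => x.2.2)
    (f := fun _ => 0) (g := fun x e => mergeRange (insertNew e x.2.1) - 1)
    (Primrec.snd.comp Primrec.snd) (Primrec.const 0) ?_).of_eq fun x => ?_
  · exact Primrec.pred.comp (primrec_mergeRange.comp (primrec_insertNew.comp Primrec.snd
      (Primrec.fst.comp (Primrec.snd.comp Primrec.fst))))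
  · obtain ⟨p, l, _ | e⟩ := x <;> rfl

lemma primrec_timeUpdate : Primrec fun x : (ℕ × ℕ × ℕ × ℕ) × List Bucket × Option ℕ × ℕ =>
    timeUpdate x.1 x.2.1 x.2.2.1 x.2.2.2 := by
  refine (Primrec.option_casesOn
    (o := fun x : (ℕ × ℕ × ℕ × ℕ) × List Bucket × Option ℕ × ℕ => x.2.2.1)
    (f := fun x => tick x.1.2.1 x.2.1) (g := fun x e => mergeNewest x.2.2.2 (insertNew e x.2.1))
    (Primrec.fst.comp (Primrec.snd.comp Primrec.snd)) ?_ ?_).of_eq fun x => ?_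
  · exact primrec_tick.comp (Primrec.fst.comp (Primrec.snd.comp Primrec.fst))
      (Primrec.fst.comp Primrec.snd)
  · exact primrec_mergeNewest.comp
      (Primrec.snd.comp (Primrec.snd.comp (Primrec.snd.comp Primrec.fst)))
      (primrec_insertNew.comp Primrec.snd (Primrec.fst.comp (Primrec.snd.comp Primrec.fst)))
  · obtain ⟨p, l, _ | e, u⟩ := x <;> rfl

lemma primrec_seqRange : Primrec fun x : (ℕ × ℕ × ℕ × ℕ) × List Bucket × ℕ =>
    seqRange x.1 x.2.1 x.2.2 :=
  primrec_timeRange.comp (Primrec.pair Primrec.fst (Primrec.pair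
    (primrec_tick.comp (Primrec.fst.comp (Primrec.snd.comp Primrec.fst))
      (Primrec.fst.comp Primrec.snd))
    (Primrec.option_some.comp (Primrec.snd.comp Primrec.snd))))

lemma primrec_seqUpdate : Primrec fun x : (ℕ × ℕ × ℕ × ℕ) × List Bucket × ℕ × ℕ =>
    seqUpdate x.1 x.2.1 x.2.2.1 x.2.2.2 :=
  primrec_timeUpdate.comp (Primrec.pair Primrec.fst (Primrec.pair
    (primrec_tick.comp (Primrec.fst.comp (Primrec.snd.comp Primrec.fst))
      (Primrec.fst.comp Primrec.snd))
    (Primrec.pair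
      (Primrec.option_some.comp (Primrec.fst.comp (Primrec.snd.comp Primrec.snd)))
      (Primrec.snd.comp (Primrec.snd.comp Primrec.snd)))))

end merge

lemma primrec_rangeAll {rng : α → σ → ℕ} {f : α → List σ} (hr : Primrec₂ rng) (hf : Primrec f) :
    Primrec fun a => rangeAll (rng a) (f a) := by
  refine Primrec.of_eq (Primrec.pred.comp (Primrec.list_foldr
    (h := fun a (q : σ × ℕ) => (rng a q.1 + 1) * q.2) hf (Primrec.const 1) ?_)) fun a => ?_
  · exact Primrec.nat_mul.comp (Primrec.succ.comp (hr.comp Primrec.fst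
      (Primrec.fst.comp Primrec.snd))) (Primrec.snd.comp Primrec.snd)
  · have : ((f a).map fun x => rng a x + 1).prod =
        (f a).foldr (fun x n => (rng a x + 1) * n) 1 := by
      induction f a with
      | nil => rfl
      | cons x l ih => simp [ih]
    rw [rangeAll, this]
    rfl

/-- A left fold whose state is the quotient still to be expanded in mixed radix together with the
output so far. -/
lemma primrec_updateAll {rng : α → σ → ℕ} {upd : α → σ → ℕ → σ} {f : α → List σ} {r : α → ℕ}
    (hr : Primrec₂ rng) (hu : Primrec fun x : α × σ × ℕ => upd x.1 x.2.1 x.2.2) (hf : Primrec f)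
    (hn : Primrec r) : Primrec fun a => updateAll (rng a) (upd a) (f a) (r a) := by
  have ha : Primrec fun y : α × (ℕ × List σ) × σ => y.1 := Primrec.fst
  have hl : Primrec fun y : α × (ℕ × List σ) × σ => y.2.2 := Primrec.snd.comp Primrec.snd
  have hd : Primrec fun y : α × (ℕ × List σ) × σ => y.2.1.1 :=
    Primrec.fst.comp (Primrec.fst.comp Primrec.snd)
  have hR : Primrec fun y : α × (ℕ × List σ) × σ => rng y.1 y.2.2 + 1 :=
    Primrec.succ.comp (hr.comp ha hl)
  have hU : Primrec fun y : α × (ℕ × List σ) × σ =>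
      upd y.1 y.2.2 (y.2.1.1 % (rng y.1 y.2.2 + 1)) :=
    hu.comp (Primrec.pair ha (Primrec.pair hl (Primrec.nat_mod.comp hd hR)))
  have hO : Primrec fun y : α × (ℕ × List σ) × σ =>
      y.2.1.2 ++ [upd y.1 y.2.2 (y.2.1.1 % (rng y.1 y.2.2 + 1))] :=
    Primrec.list_concat.comp (Primrec.snd.comp (Primrec.fst.comp Primrec.snd)) hU
  refine (Primrec.snd.comp (Primrec.list_foldl
    (h := fun a (q : (ℕ × List σ) × σ) => (q.1.1 / (rng a q.2 + 1),
      q.1.2 ++ [upd a q.2 (q.1.1 % (rng a q.2 + 1))])) hf (Primrec.pair hn (Primrec.const []))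
    (Primrec.pair (Primrec.nat_div.comp hd hR) hO).to₂)).of_eq fun a => ?_
  have key : ∀ (l : List σ) (r : ℕ) (o : List σ), (l.foldl (fun (q : ℕ × List σ) x =>
      (q.1 / (rng a x + 1), q.2 ++ [upd a x (q.1 % (rng a x + 1))])) (r, o)).2 =
      o ++ updateAll (rng a) (upd a) l r := by
    intro l
    induction l with
    | nil => intro r o; simp [updateAll]
    | cons x l ih => intro r o; rw [List.foldl_cons, ih, updateAll]; simp
  exact key (f a) (r a) []

lemma effective_copiesAlgorithm {rng : ℕ × ℕ × ℕ × ℕ → List Bucket → α → ℕ}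
    {upd : ℕ × ℕ × ℕ × ℕ → List Bucket → α → ℕ → List Bucket}
    {copies : ℕ × ℕ × ℕ × ℕ → ℕ} {answer : ℕ × ℕ × ℕ × ℕ → List (List Bucket) → ℕ × ℕ}
    (hr : Primrec fun x : (ℕ × ℕ × ℕ × ℕ) × List Bucket × α => rng x.1 x.2.1 x.2.2)
    (hu : Primrec fun x : (ℕ × ℕ × ℕ × ℕ) × List Bucket × α × ℕ => upd x.1 x.2.1 x.2.2.1 x.2.2.2)
    (hc : Computable copies) (ha : Computable₂ answer) :
    (copiesAlgorithm rng upd copies answer).Effective := by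
  refine ⟨?_, ?_, ?_, Computable.const 0, ?_⟩
  · have h : Primrec fun n => encodeState (List.replicate n []) :=
      (primrec_encodeState.comp (Primrec.list_map Primrec.list_range
        (Primrec.const ([] : List Bucket)).to₂)).of_eq fun n => by
        rw [List.map_const', List.length_range]
    exact h.to_comp.comp hc
  · have h0 : Primrec fun y : ((ℕ × ℕ × ℕ × ℕ) × List Bool × α) × List Bucket =>
        (y.1.1, y.2, y.1.2.2) :=
      Primrec.pair (Primrec.fst.comp Primrec.fst) (Primrec.pair Primrec.snd
        (Primrec.snd.comp (Primrec.snd.comp Primrec.fst)))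
    have h1 := hr.comp h0
    have h2 : Primrec fun x : (ℕ × ℕ × ℕ × ℕ) × List Bool × α => decodeState x.2.1 :=
      primrec_decodeState.comp (Primrec.fst.comp Primrec.snd)
    have h3 := primrec_rangeAll
      (rng := fun (x : (ℕ × ℕ × ℕ × ℕ) × List Bool × α) l => rng x.1 l x.2.2) h1 h2
    exact h3.to_comp
  · have h0 : Primrec fun y : ((ℕ × ℕ × ℕ × ℕ) × List Bool × α × ℕ) × List Bucket =>
        (y.1.1, y.2, y.1.2.2.1) :=
      Primrec.pair (Primrec.fst.comp Primrec.fst) (Primrec.pair Primrec.snd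
        (Primrec.fst.comp (Primrec.snd.comp (Primrec.snd.comp Primrec.fst))))
    have h1 := hr.comp h0
    have h2 : Primrec fun y : ((ℕ × ℕ × ℕ × ℕ) × List Bool × α × ℕ) × List Bucket × ℕ =>
        (y.1.1, y.2.1, y.1.2.2.1, y.2.2) :=
      Primrec.pair (Primrec.fst.comp Primrec.fst) (Primrec.pair (Primrec.fst.comp Primrec.snd)
        (Primrec.pair (Primrec.fst.comp (Primrec.snd.comp (Primrec.snd.comp Primrec.fst)))
          (Primrec.snd.comp Primrec.snd)))
    have h3 := hu.comp h2
    have h4 : Primrec fun x : (ℕ × ℕ × ℕ × ℕ) × List Bool × α × ℕ => decodeState x.2.1 :=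
      primrec_decodeState.comp (Primrec.fst.comp Primrec.snd)
    have h5 : Primrec fun x : (ℕ × ℕ × ℕ × ℕ) × List Bool × α × ℕ => x.2.2.2 :=
      Primrec.snd.comp (Primrec.snd.comp Primrec.snd)
    have h6 := primrec_encodeState.comp (primrec_updateAll
      (rng := fun (x : (ℕ × ℕ × ℕ × ℕ) × List Bool × α × ℕ) l => rng x.1 l x.2.2.1)
      (upd := fun (x : (ℕ × ℕ × ℕ × ℕ) × List Bool × α × ℕ) l u => upd x.1 l x.2.2.1 u)
      h1 h3 h4 h5)
    exact h6.to_comp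
  · have h1 : Computable fun x : (ℕ × ℕ × ℕ × ℕ) × List Bool × ℕ => decodeState x.2.1 :=
      primrec_decodeState.to_comp.comp (Computable.fst.comp Computable.snd)
    exact Computable₂.comp (f := answer) ha Computable.fst h1

lemma primrec_groupSums : Primrec fun x : ℕ × ℕ × List ℕ => groupSums x.1 x.2.1 x.2.2 := by
  refine Primrec.list_map (Primrec.list_range.comp (Primrec.fst.comp Primrec.snd)) ?_
  have ha : Primrec fun y : (ℕ × ℕ × List ℕ) × ℕ => y.1.1 := Primrec.fst.comp Primrec.fst
  exact primrec_list_sum.comp (Primrec.list_take.comp ha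
    (Primrec.list_drop.comp (Primrec.nat_mul.comp Primrec.snd ha)
      (Primrec.snd.comp (Primrec.snd.comp Primrec.fst))))

lemma computable_median : Computable median := by
  have hc : Primrec₂ fun (vs : List ℕ) (y : ℕ) => vs.countP (· ≤ y) := by
    refine (Primrec.list_foldr (h := fun (x : List ℕ × ℕ) (q : ℕ × ℕ) =>
      if q.1 ≤ x.2 then q.2 + 1 else q.2) (f := fun x : List ℕ × ℕ => x.1) Primrec.fst
      (Primrec.const 0) ?_).of_eq fun x => ?_
    · have hn : Primrec fun y : (List ℕ × ℕ) × ℕ × ℕ => y.2.2 := Primrec.snd.comp Primrec.snd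
      exact Primrec.ite (PrimrecRel.comp Primrec.nat_le (Primrec.fst.comp Primrec.snd)
        (Primrec.snd.comp Primrec.fst)) (Primrec.succ.comp hn) hn
    · obtain ⟨l, y⟩ := x
      induction l with
      | nil => rfl
      | cons v l ih =>
        simp only at ih
        simp only [List.foldr_cons, ih, List.countP_cons]
        by_cases h : v ≤ y <;> simp [h]
  have hp : Computable₂ fun (vs : List ℕ) (y : ℕ) =>
      decide (vs.length ≤ 2 * vs.countP (· ≤ y)) :=
    (Primrec.nat_le.decide.comp (Primrec.list_length.comp Primrec.fst)
      (Primrec.nat_double.comp (hc.comp Primrec.fst Primrec.snd))).to_comp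
  have hex : ∀ vs : List ℕ, ∃ y, decide (vs.length ≤ 2 * vs.countP (· ≤ y)) = true := fun vs => by
    simpa only [decide_eq_true_eq] using exists_median vs
  refine (computable_find hp hex).of_eq fun vs => ?_
  rw [median]
  congr 1
  funext y
  simp only [decide_eq_true_eq]

lemma computable_weight {φ : α → Sample → ℕ} (hφ : Computable₂ φ) :
    Computable₂ fun a l => weight (φ a) l := by
  have hterm : Computable₂ fun (a : α) (b : Bucket) => b.1 * φ a b.2.2 :=
    Primrec.nat_mul.to_comp.comp (Computable.fst.comp Computable.snd)
      (hφ.comp Computable.fst (Computable.snd.comp (Computable.snd.comp Computable.snd)))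
  exact primrec_list_sum.to_comp.comp (computable_list_map (f := fun x : α × List Bucket => x.2)
    Computable.snd (hterm.comp (Computable.fst.comp Computable.fst) Computable.snd).to₂)

end computability

end WindowSketch

namespace WindowSketch

/-! Memory. -/

lemma length_encodeNum (n : ℕ) : (encodeNum n).length = 2 * n.size + 2 := by
  have : ∀ bs : List Bool, (bs.flatMap fun b => [true, b]).length = 2 * bs.length := by
    intro bs
    induction bs with
    | nil => rfl
    | cons b bs ih => simp [ih]; ring
  rw [encodeNum, List.length_append, this, Nat.size_eq_bits_len]
  rfl

lemma length_encodeBuckets_le {s : ℕ} {l : List Bucket}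
    (h : ∀ b ∈ l, (Encodable.encode b).size ≤ s) :
    (encodeBuckets l).length ≤ l.length * (2 * s + 2) + 2 := by
  rw [encodeBuckets, List.length_append]
  refine Nat.add_le_add_right ?_ 2
  induction l with
  | nil => simp
  | cons b l ih =>
    have h1 := h b (by simp)
    have h2 := ih fun x hx => h x (by simp [hx])
    rw [List.flatMap_cons, List.length_append, length_encodeNum, List.length_cons, add_mul, one_mul]
    omega

lemma length_encodeState_le {B : ℝ} {ss : List (List Bucket)}
    (h : ∀ l ∈ ss, ((encodeBuckets l).length : ℝ) ≤ B) :
    ((encodeState ss).length : ℝ) ≤ ss.length * B := by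
  rw [encodeState]
  induction ss with
  | nil => simp
  | cons l ss ih =>
    have h1 := h l (by simp)
    have h2 := ih fun x hx => h x (by simp [hx])
    rw [List.flatMap_cons, List.length_append, List.length_cons]
    push_cast
    linarith

lemma pair_lt_two_pow {a b s : ℕ} (ha : a < 2 ^ s) (hb : b < 2 ^ s) :
    Nat.pair a b < 2 ^ (2 * s) := by
  refine (Nat.pair_lt_max_add_one_sq a b).trans_le ?_
  rw [mul_comm, pow_mul]
  exact Nat.pow_le_pow_left (max_lt ha hb) 2

/-- A bucket is coded by four nested pairings, and each at most doubles the number of digits. -/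
lemma size_encode_bucket_le {s : ℕ} {b : Bucket} (h1 : b.1 < 2 ^ s) (h2 : b.2.1 < 2 ^ s)
    (h3 : b.2.2.1 < 2 ^ s) (h4 : b.2.2.2.1 < 2 ^ s) (h5 : b.2.2.2.2 < 2 ^ s) :
    (Encodable.encode b).size ≤ 16 * s := by
  rw [Nat.size_le]
  have mono : ∀ {a c d : ℕ}, a < 2 ^ c → c ≤ d → a < 2 ^ d := fun h hcd =>
    h.trans_le (Nat.pow_le_pow_right two_pos hcd)
  have e : Encodable.encode b = Nat.pair b.1 (Nat.pair b.2.1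
      (Nat.pair b.2.2.1 (Nat.pair b.2.2.2.1 b.2.2.2.2))) := rfl
  have p1 := pair_lt_two_pow h4 h5
  have p2 := pair_lt_two_pow (mono h3 (by omega)) p1
  have p3 := pair_lt_two_pow (mono h2 (by omega)) p2
  have p4 := pair_lt_two_pow (mono h1 (by omega)) p3
  rw [e]
  exact mono p4 (by omega)

/-! ### Memory of one copy. -/

section buckets

variable {t m n : ℕ} {c : ℕ → ℕ}

lemma Good.entries_le (hc : ∀ a, a < t → c a ≤ n) : ∀ {l : List Bucket}, Good t m c l →
    ∀ b ∈ l, b.1 ≤ n ∧ b.2.1 ≤ t ∧ b.2.2.1 ≤ m ∧ b.2.2.2.1 ≤ t ∧ b.2.2.2.2 ≤ n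
  | [], _, b, hb => by simp at hb
  | b' :: l, h, b, hb => by
    obtain ⟨h1, h2, h3, h4, h5, h6, h7⟩ := h
    rcases List.mem_cons.1 hb with rfl | hb
    · have := hc _ h4
      refine ⟨by omega, h4.le, ?_⟩
      obtain ⟨-, s2 | s2⟩ := h5
      · exact ⟨s2.2.1, s2.1.le, s2.2.2.trans (hc _ s2.1)⟩
      · rw [s2]; simp
    · exact Good.entries_le hc h7 b hb

/-- `Sparse` bounds the length of the tail by the logarithm of its total, and that total is smaller
than the number of window elements. -/
lemma Good.length_le {s : ℕ} (hc : ∀ a, a < t → c a ≤ n) (hn : n < 2 ^ s) {l : List Bucket}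
    (h : Good t m c l) (hs : Sparse l) : l.length ≤ 2 * s := by
  cases l with
  | nil => simp
  | cons b l =>
    have h1 := hs.1
    have h2 := h.2.2.1
    have h3 := hc _ h.2.2.2.1
    have h4 : l.length / 2 < s := (Nat.pow_lt_pow_iff_right one_lt_two).1
      (by omega : 2 ^ (l.length / 2) < 2 ^ s)
    rw [List.length_cons]
    omega

lemma log_two_bounds : (0.69 : ℝ) < Real.log 2 ∧ Real.log 2 < 0.7 :=
  ⟨by linarith [Real.log_two_gt_d9], by linarith [Real.log_two_lt_d9]⟩

lemma size_le_log {X : ℕ} : (X.size : ℝ) ≤ 3 * Real.log (2 + X) := by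
  obtain ⟨l1, l2⟩ := log_two_bounds
  have hmono : Real.log 2 ≤ Real.log (2 + X) :=
    Real.log_le_log two_pos (by linarith [Nat.cast_nonneg (α := ℝ) X])
  rcases Nat.eq_zero_or_pos X.size with h | h
  · rw [h]; simp; linarith
  · have h1 : 2 ^ (X.size - 1) ≤ X := Nat.lt_size.1 (by omega)
    have h2 : (2 : ℝ) ^ (X.size - 1) ≤ 2 + X := by
      have : ((2 ^ (X.size - 1) : ℕ) : ℝ) ≤ X := by exact_mod_cast h1
      push_cast at this
      linarith
    have h3 := Real.log_le_log (by positivity) h2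
    rw [Real.log_pow, Nat.cast_sub h, Nat.cast_one] at h3
    have h4 : (1 : ℝ) ≤ X.size := by exact_mod_cast h
    nlinarith

/-- One copy stores only polylogarithmically many bits. -/
lemma Good.length_encodeBuckets_le (hm : 1 ≤ m) (hc : ∀ a, a < t → c a ≤ n) {l : List Bucket}
    (h : Good t m c l) (hs : Sparse l) :
    ((encodeBuckets l).length : ℝ) ≤ 630 * Real.log (2 + m * t * n) ^ 2 := by
  obtain ⟨l1, l2⟩ := log_two_bounds
  have hL : (0.69 : ℝ) < Real.log (2 + m * t * n) :=
    l1.trans_le (Real.log_le_log two_pos (by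
      have : (0 : ℝ) ≤ m * t * n := by positivity
      linarith))
  have hL2 : (0.47 : ℝ) ≤ Real.log (2 + m * t * n) ^ 2 := by
    have := pow_le_pow_left₀ (by norm_num) hL.le 2
    exact le_trans (by norm_num) this
  cases l with
  | nil =>
    have h2 : (encodeBuckets []).length ≤ 0 * (2 * 0 + 2) + 2 :=
      WindowSketch.length_encodeBuckets_le (l := []) (by simp)
    have h3 : ((encodeBuckets []).length : ℝ) ≤ 2 := by exact_mod_cast h2
    linarith
  | cons b l =>
    have hbt : b.2.1 < t := h.2.2.2.1
    have hn : 1 ≤ n := by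
      exact h.1.trans (h.entries_le hc b (by simp)).1
    have ht : 1 ≤ t := Nat.one_le_of_lt hbt
    obtain ⟨s, hs_def⟩ : ∃ s, s = (m * t * n).size := ⟨_, rfl⟩
    have hX : m * t * n < 2 ^ s := hs_def ▸ Nat.lt_size_self _
    have hmX : m ≤ m * t * n := by
      rw [mul_assoc]; exact Nat.le_mul_of_pos_right _ (Nat.mul_pos ht hn)
    have htX : t ≤ m * t * n := by
      rw [mul_comm m t, mul_assoc]; exact Nat.le_mul_of_pos_right _ (Nat.mul_pos hm hn)
    have hnX : n ≤ m * t * n := Nat.le_mul_of_pos_left _ (Nat.mul_pos hm ht)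
    have hs1 : 1 ≤ s := hs_def ▸ Nat.size_pos.2 (by omega)
    have hle : ∀ x ∈ b :: l, (Encodable.encode x).size ≤ 16 * s := fun x hx => by
      obtain ⟨e1, e2, e3, e4, e5⟩ := h.entries_le hc x hx
      exact size_encode_bucket_le (s := s) (e1.trans_lt (hnX.trans_lt hX))
        (e2.trans_lt (htX.trans_lt hX)) (e3.trans_lt (hmX.trans_lt hX))
        (e4.trans_lt (htX.trans_lt hX)) (e5.trans_lt (hnX.trans_lt hX))
    have h1 := WindowSketch.length_encodeBuckets_le hle
    have h2 := h.length_le hc (hnX.trans_lt hX) hs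
    -- At most `2 s` buckets of `2 * 16 s + 2` bits and an end mark of 2 bits.
    have h3 : (encodeBuckets (b :: l)).length ≤ 70 * s ^ 2 := by
      refine h1.trans ?_
      have h5 := Nat.mul_le_mul_right (2 * (16 * s) + 2) h2
      refine (Nat.add_le_add_right h5 2).trans ?_
      have h6 : s ≤ s ^ 2 := Nat.le_self_pow two_ne_zero s
      have h7 : 2 * s * (2 * (16 * s) + 2) = 64 * s ^ 2 + 4 * s := by ring
      omega
    have h4 : (s : ℝ) ≤ 3 * Real.log (2 + m * t * n) := by
      have := size_le_log (X := m * t * n)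
      rw [← hs_def] at this
      push_cast at this
      exact this
    have h5 : ((encodeBuckets (b :: l)).length : ℝ) ≤ 70 * (s : ℝ) ^ 2 := by exact_mod_cast h3
    have h6 : (s : ℝ) ^ 2 ≤ (3 * Real.log (2 + m * t * n)) ^ 2 :=
      pow_le_pow_left₀ (Nat.cast_nonneg _) h4 2
    linarith

end buckets

/-! Parameters of the algorithm. -/

lemma exists_groupCount (d : ℕ) : ∃ b, decide (d ≤ 2 ^ b) = true :=
  ⟨d, by simpa using Nat.lt_two_pow_self.le⟩

/-- The number of groups over which the median is taken. -/
def groupCount (p : ℕ × ℕ × ℕ × ℕ) : ℕ := Nat.find (exists_groupCount p.2.2.2)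

/-- The number of estimates in a group. -/
def groupSize (K : ℕ) (sz : ℕ → ℕ) (p : ℕ × ℕ × ℕ × ℕ) : ℕ := K * sz p.1 * p.2.2.1 ^ 2

/-- The number of independent copies. -/
def copyCount (K : ℕ) (sz : ℕ → ℕ) (p : ℕ × ℕ × ℕ × ℕ) : ℕ := groupSize K sz p * groupCount p

/-- Rounded increments of the scaled power function. -/
def roundedInc (pw : ℕ × ℕ → ℕ) (p : ℕ × ℕ × ℕ × ℕ) (r : ℕ) : ℕ :=
  pw (r, 8 * p.2.2.1) - pw (r - 1, 8 * p.2.2.1)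

/-- The scaled estimate of one copy. -/
def estimate (pw : ℕ × ℕ → ℕ) (p : ℕ × ℕ × ℕ × ℕ) (l : List Bucket) : ℕ :=
  weight (fun x => roundedInc pw p x.2.2) l

/-- The answer of the algorithm. -/
def medianAnswer (pw : ℕ × ℕ → ℕ) (K : ℕ) (sz : ℕ → ℕ) (p : ℕ × ℕ × ℕ × ℕ)
    (ss : List (List Bucket)) : ℕ × ℕ :=
  (median (groupSums (groupSize K sz p) (groupCount p) (ss.map (estimate pw p))),
    (8 * p.2.2.1 + 1) * groupSize K sz p - 1)

lemma computable_groupCount : Computable groupCount := by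
  have h : Computable₂ fun d b : ℕ => decide (d ≤ 2 ^ b) :=
    (Primrec.nat_le.decide.comp Primrec.fst
      (primrec_pow.comp (Primrec.const 2) Primrec.snd)).to_comp
  exact (computable_find h exists_groupCount).comp
    (Computable.snd.comp (Computable.snd.comp Computable.snd))

lemma computable_groupSize (K : ℕ) {sz : ℕ → ℕ} (hsz : Computable sz) :
    Computable (groupSize K sz) := by
  have hmul : Computable₂ ((· * ·) : ℕ → ℕ → ℕ) := Primrec.nat_mul.to_comp
  have hpow : Computable₂ ((· ^ ·) : ℕ → ℕ → ℕ) := primrec_pow.to_comp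
  exact hmul.comp (hmul.comp (Computable.const K) (hsz.comp Computable.fst))
    (hpow.comp (Computable.fst.comp (Computable.snd.comp Computable.snd)) (Computable.const 2))

lemma computable_copyCount (K : ℕ) {sz : ℕ → ℕ} (hsz : Computable sz) :
    Computable (copyCount K sz) :=
  Primrec.nat_mul.to_comp.comp (computable_groupSize K hsz) computable_groupCount

lemma computable_medianAnswer {pw : ℕ × ℕ → ℕ} (K : ℕ) {sz : ℕ → ℕ} (hpw : Computable pw)
    (hsz : Computable sz) : Computable₂ (medianAnswer pw K sz) := by
  have hmul : Computable₂ ((· * ·) : ℕ → ℕ → ℕ) := Primrec.nat_mul.to_comp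
  have hsub : Computable₂ ((· - ·) : ℕ → ℕ → ℕ) := Primrec.nat_sub.to_comp
  have hD : Computable fun p : ℕ × ℕ × ℕ × ℕ => 8 * p.2.2.1 :=
    hmul.comp (Computable.const 8) (Computable.fst.comp (Computable.snd.comp Computable.snd))
  have hφ : Computable₂ fun (p : ℕ × ℕ × ℕ × ℕ) (x : Sample) => roundedInc pw p x.2.2 := by
    have hr : Computable fun y : (ℕ × ℕ × ℕ × ℕ) × Sample => y.2.2.2 :=
      Computable.snd.comp (Computable.snd.comp Computable.snd)
    have hd : Computable fun y : (ℕ × ℕ × ℕ × ℕ) × Sample => 8 * y.1.2.2.1 :=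
      hD.comp Computable.fst
    exact hsub.comp (hpw.comp (Computable.pair hr hd))
      (hpw.comp (Computable.pair (Computable.pred.comp hr) hd))
  have hest : Computable₂ (estimate pw) := computable_weight hφ
  have hmap : Computable fun x : (ℕ × ℕ × ℕ × ℕ) × List (List Bucket) =>
      x.2.map (estimate pw x.1) :=
    computable_list_map (g := fun (x : (ℕ × ℕ × ℕ × ℕ) × List (List Bucket)) l =>
      estimate pw x.1 l) Computable.snd
      (Computable₂.comp (f := estimate pw) hest (Computable.fst.comp Computable.fst)
        Computable.snd).to₂
  have hS : Computable fun x : (ℕ × ℕ × ℕ × ℕ) × List (List Bucket) => groupSize K sz x.1 :=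
    (computable_groupSize K hsz).comp Computable.fst
  have hB : Computable fun x : (ℕ × ℕ × ℕ × ℕ) × List (List Bucket) => groupCount x.1 :=
    computable_groupCount.comp Computable.fst
  have h1 := computable_median.comp
    (primrec_groupSums.to_comp.comp (Computable.pair hS (Computable.pair hB hmap)))
  have h2 : Computable fun x : (ℕ × ℕ × ℕ × ℕ) × List (List Bucket) =>
      (8 * x.1.2.2.1 + 1) * groupSize K sz x.1 - 1 :=
    Computable.pred.comp (hmul.comp (Computable.succ.comp (hD.comp Computable.fst)) hS)
  exact Computable.pair h1 h2

/-! ### Accuracy and total memory. -/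

section parameters

variable {k ε δ : ℝ} {K m t : ℕ} {pw : ℕ × ℕ → ℕ} {sz : ℕ → ℕ}

lemma ceil_inv_bounds (h0 : 0 < ε) (h1 : ε < 1) :
    1 ≤ ε * ⌈1 / ε⌉₊ ∧ ε * ⌈1 / ε⌉₊ ≤ 2 := by
  have e := Nat.le_ceil (1 / ε)
  have e2 := Nat.ceil_lt_add_one (show 0 ≤ 1 / ε by positivity)
  have e3 : ε * (1 / ε) = 1 := mul_one_div_cancel h0.ne'
  constructor
  · calc (1 : ℝ) = ε * (1 / ε) := e3.symm
      _ ≤ _ := mul_le_mul_of_nonneg_left e h0.le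
  · have := mul_le_mul_of_nonneg_left e2.le h0.le
    rw [mul_add, e3] at this
    linarith

/-- Minimality gives `2 ^ (groupCount p - 1) < ⌈1 / δ⌉₊ ≤ 2 / δ`. -/
lemma groupCount_bounds (h0 : 0 < δ) (h1 : δ < 1) (p : ℕ × ℕ × ℕ × ℕ) (hp : p.2.2.2 = ⌈1 / δ⌉₊) :
    ((2 : ℝ) ^ groupCount p)⁻¹ ≤ δ ∧ (groupCount p : ℝ) ≤ 3 * Real.log (2 / δ) := by
  obtain ⟨l1, l2⟩ := log_two_bounds
  obtain ⟨d1, d2⟩ := ceil_inv_bounds h0 h1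
  have hspec := Nat.find_spec (exists_groupCount p.2.2.2)
  have hmin := fun {j} => Nat.find_min (exists_groupCount p.2.2.2) (m := j)
  change decide (p.2.2.2 ≤ 2 ^ groupCount p) = true at hspec
  change ∀ {j}, j < groupCount p → _ at hmin
  rw [decide_eq_true_eq, hp] at hspec
  constructor
  · have h3 : (⌈1 / δ⌉₊ : ℝ) ≤ 2 ^ groupCount p := by exact_mod_cast hspec
    rw [inv_le_iff_one_le_mul₀ (by positivity)]
    exact d1.trans (mul_le_mul_of_nonneg_left h3 h0.le)
  · have hmono : Real.log 2 ≤ Real.log (2 / δ) :=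
      Real.log_le_log two_pos (by rw [le_div_iff₀ h0]; linarith)
    rcases Nat.eq_zero_or_pos (groupCount p) with h | h
    · rw [h]; simp; linarith
    · have h2 := hmin (Nat.sub_lt h one_pos)
      rw [decide_eq_true_eq, hp, not_le] at h2
      have h3 : (2 : ℝ) ^ (groupCount p - 1) ≤ 2 / δ := by
        rw [le_div_iff₀ h0]
        have : (2 : ℝ) ^ (groupCount p - 1) ≤ ⌈1 / δ⌉₊ := by exact_mod_cast h2.le
        nlinarith
      have h4 := Real.log_le_log (by positivity) h3
      rw [Real.log_pow, Nat.cast_sub h, Nat.cast_one] at h4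
      have h5 : (1 : ℝ) ≤ groupCount p := by exact_mod_cast h
      nlinarith

/-- The states of the algorithm need little memory. -/
lemma length_encodeState_le_of_mem_support
    (hsz : ∀ m : ℕ, 1 ≤ m → (sz m : ℝ) ≤ 12 * (m : ℝ) ^ (1 - 1 / k)) (hm : 1 ≤ m) (ht : 1 ≤ t)
    (hε0 : 0 < ε) (hε1 : ε < 1) (hδ0 : 0 < δ) (hδ1 : δ < 1) {stream : List (Option ℕ)}
    (hs : ∀ x : ℕ, some x ∈ stream → 1 ≤ x ∧ x ≤ m) {p : ℕ × ℕ × ℕ × ℕ}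
    (hp : p = (m, t, ⌈1 / ε⌉₊, ⌈1 / δ⌉₊)) {ss : List (List Bucket)}
    (hss : ss ∈ (listPow (copyLaw timeRange timeUpdate p stream (PMF.pure []))
      (copyCount K sz p)).support) :
    ((encodeState ss).length : ℝ) ≤ 90720 * K * (1 / ε ^ 2) * Real.log (2 / δ) *
      (m : ℝ) ^ (1 - 1 / k) * Real.log (2 + m * t * (timeWindow t stream).length) ^ 2 := by
  obtain ⟨h1, h2⟩ := mem_support_listPow hss
  have ht' : 1 ≤ p.2.1 := by rw [hp]; exact ht
  have h3 := length_encodeState_le (ss := ss)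
    (B := 630 * Real.log (2 + m * t * (timeWindow t stream).length) ^ 2) fun l hl => by
    obtain ⟨hg, hsp⟩ := good_sparse_of_mem_support ht' stream hs l (h2 l hl)
    have e : p.2.1 = t := by rw [hp]
    rw [e] at hg
    exact hg.length_encodeBuckets_le hm (fun a ha => length_timeWindow_mono ha stream) hsp
  obtain ⟨-, hb⟩ := groupCount_bounds hδ0 hδ1 p (by rw [hp])
  obtain ⟨-, hE⟩ := ceil_inv_bounds hε0 hε1
  have hS : (groupSize K sz p : ℝ) ≤ 48 * K * (1 / ε ^ 2) * (m : ℝ) ^ (1 - 1 / k) := by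
    have hE2 : (⌈1 / ε⌉₊ : ℝ) ^ 2 ≤ 4 * (1 / ε ^ 2) := by
      have : (⌈1 / ε⌉₊ : ℝ) ≤ 2 / ε := by rw [le_div_iff₀ hε0]; linarith
      calc (⌈1 / ε⌉₊ : ℝ) ^ 2 ≤ (2 / ε) ^ 2 := pow_le_pow_left₀ (Nat.cast_nonneg _) this 2
        _ = _ := by rw [div_pow]; ring
    rw [groupSize, hp]
    push_cast
    calc (K : ℝ) * sz m * (⌈1 / ε⌉₊ : ℝ) ^ 2
        ≤ K * (12 * (m : ℝ) ^ (1 - 1 / k)) * (4 * (1 / ε ^ 2)) := by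
          have := hsz m hm
          gcongr
      _ = _ := by ring
  rw [h1] at h3
  refine h3.trans ?_
  rw [copyCount, Nat.cast_mul]
  have hlog : 0 ≤ Real.log (2 / δ) := Real.log_nonneg (by rw [le_div_iff₀ hδ0]; linarith)
  calc (groupSize K sz p : ℝ) * groupCount p *
        (630 * Real.log (2 + m * t * (timeWindow t stream).length) ^ 2)
      ≤ (48 * K * (1 / ε ^ 2) * (m : ℝ) ^ (1 - 1 / k)) * (3 * Real.log (2 / δ)) *
        (630 * Real.log (2 + m * t * (timeWindow t stream).length) ^ 2) := by gcongr
    _ = _ := by ring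

/-- Two roundings cost at most 2. The scale `8 * ⌈1 / ε⌉₊ + 1` makes this at most `ε / 4` of the
scaled increment, since an increment is at least 1. The same estimate shows that the subtraction in
`roundedInc` is not truncated. -/
lemma roundedInc_bounds (hk : 2 < k)
    (hpw : ∀ x : ℕ × ℕ, |(pw x : ℝ) - (x.2 + 1) * (x.1 : ℝ) ^ k| ≤ 1) (p : ℕ × ℕ × ℕ × ℕ)
    (hE : 1 ≤ ε * p.2.2.1) (hε1 : ε < 1) {r : ℕ} (hr : 1 ≤ r) :
    |(roundedInc pw p r : ℝ) - ((8 * p.2.2.1 + 1 : ℕ) : ℝ) * powInc k r| ≤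
        ε / 4 * ((8 * p.2.2.1 + 1 : ℕ) : ℝ) * powInc k r ∧
      (roundedInc pw p r : ℝ) ≤ 2 * ((8 * p.2.2.1 + 1 : ℕ) : ℝ) * powInc k r := by
  have h1 := abs_le.1 (hpw (r, 8 * p.2.2.1))
  have h2 := abs_le.1 (hpw (r - 1, 8 * p.2.2.1))
  have h3 := one_le_powInc (k := k) (by linarith) hr
  set E := p.2.2.1
  set Δ : ℝ := ((8 * E + 1 : ℕ) : ℝ) with hΔ
  have e : ((8 * E : ℕ) : ℝ) + 1 = Δ := by rw [hΔ]; push_cast; ring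
  simp only [e] at h1 h2
  have hdiff : Δ * powInc k r = Δ * (r : ℝ) ^ k - Δ * ((r - 1 : ℕ) : ℝ) ^ k := by
    rw [powInc]; ring
  have hεΔ : 2 ≤ ε / 4 * Δ := by
    rw [hΔ]; push_cast
    have : 0 < ε := by
      by_contra hneg
      nlinarith [Nat.cast_nonneg (α := ℝ) E]
    nlinarith
  have hΔ2 : 2 ≤ Δ := by nlinarith [Nat.cast_nonneg (α := ℝ) (8 * E + 1)]
  have hge : pw (r - 1, 8 * E) ≤ pw (r, 8 * E) := by
    have : (pw (r - 1, 8 * E) : ℝ) ≤ pw (r, 8 * E) := by nlinarith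
    exact_mod_cast this
  have hval : (roundedInc pw p r : ℝ) = pw (r, 8 * E) - pw (r - 1, 8 * E) := by
    rw [roundedInc, Nat.cast_sub hge]
  rw [hval]
  have habs : |(pw (r, 8 * E) : ℝ) - pw (r - 1, 8 * E) - Δ * powInc k r| ≤ 2 := by
    rw [hdiff, abs_le]
    constructor <;> linarith
  constructor
  · refine habs.trans ?_
    nlinarith
  · have := (abs_le.1 habs).2
    nlinarith

lemma roundedInc_zero (p : ℕ × ℕ × ℕ × ℕ) : roundedInc pw p 0 = 0 := by
  simp [roundedInc]

/-- The answers are accurate. -/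
lemma le_toOuterMeasure_medianAnswer (hk : 2 < k) (hK : 1920 * k ≤ K)
    (hpw : ∀ x : ℕ × ℕ, |(pw x : ℝ) - (x.2 + 1) * (x.1 : ℝ) ^ k| ≤ 1)
    (hsz : ∀ m : ℕ, 1 ≤ m → (m : ℝ) ^ (1 - 1 / k) ≤ sz m) (hm : 1 ≤ m) (ht : 1 ≤ t)
    (hε0 : 0 < ε) (hε1 : ε < 1) (hδ0 : 0 < δ) (hδ1 : δ < 1) {stream : List (Option ℕ)}
    (hs : ∀ x : ℕ, some x ∈ stream → 1 ≤ x ∧ x ≤ m) {p : ℕ × ℕ × ℕ × ℕ}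
    (hp : p = (m, t, ⌈1 / ε⌉₊, ⌈1 / δ⌉₊)) :
    ENNReal.ofReal (1 - δ) ≤
      ((listPow (copyLaw timeRange timeUpdate p stream (PMF.pure [])) (copyCount K sz p)).map
        fun ss => ((medianAnswer pw K sz p ss).1 : ℝ) /
          ((medianAnswer pw K sz p ss).2 + 1)).toOuterMeasure
        {y | |y - freqMoment k m (timeWindow t stream)| ≤
          ε * freqMoment k m (timeWindow t stream)} := by
  have hk0 : 0 < k := by linarith
  have ht' : 1 ≤ p.2.1 := by rw [hp]; exact ht
  have htp : p.2.1 = t := by rw [hp]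
  have hEp : p.2.2.1 = ⌈1 / ε⌉₊ := by rw [hp]
  obtain ⟨hE1, -⟩ := ceil_inv_bounds hε0 hε1
  rw [← hEp] at hE1
  set w := timeWindow t stream with hw_def
  have hw : ∀ x ∈ w, 1 ≤ x ∧ x ≤ m := fun x hx => hs x (mem_timeWindow hx)
  set F := freqMoment k m w with hF_def
  have hF0 : 0 ≤ F := freqMoment_nonneg w
  set G := roundedInc pw p with hG_def
  set Δ : ℝ := ((8 * p.2.2.1 + 1 : ℕ) : ℝ) with hΔ_def
  have hΔ0 : 0 < Δ := by rw [hΔ_def]; exact_mod_cast Nat.succ_pos _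
  have hG := fun r (hr : 1 ≤ r) => roundedInc_bounds (r := r) hk hpw p hE1 hε1 hr
  set a := groupSize K sz p with ha_def
  have hmk : 1 ≤ (m : ℝ) ^ (1 - 1 / k) := by
    refine Real.one_le_rpow (by exact_mod_cast hm) ?_
    rw [sub_nonneg, div_le_one hk0]
    linarith
  have ha_lower : 1920 * k * (m : ℝ) ^ (1 - 1 / k) ≤ ε ^ 2 * a := by
    have e : ε ^ 2 * (a : ℝ) = K * sz m * (ε * p.2.2.1) ^ 2 := by
      rw [ha_def, groupSize]
      have : p.1 = m := by rw [hp]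
      rw [this]
      push_cast
      ring
    rw [e]
    have h1 := hsz m hm
    have h2 : 1 ≤ (ε * (p.2.2.1 : ℝ)) ^ 2 := one_le_pow₀ hE1
    calc 1920 * k * (m : ℝ) ^ (1 - 1 / k) ≤ K * sz m := by gcongr
      _ ≤ K * sz m * (ε * p.2.2.1) ^ 2 := le_mul_of_one_le_right (by positivity) h2
  have ha0 : 0 < a := by
    rcases Nat.eq_zero_or_pos a with h | h
    · rw [h, Nat.cast_zero, mul_zero] at ha_lower
      nlinarith
    · exact h
  have haR : (0 : ℝ) < a := by exact_mod_cast ha0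
  obtain ⟨hE, hV⟩ := expect_estimate ht' G (roundedInc_zero p) stream hs
  rw [htp] at hE hV
  set M := rankSum G w with hM_def
  set V := 2 * w.length * rankSum (fun r => G r ^ 2) w with hV_def
  have hM : |(M : ℝ) - Δ * F| ≤ ε / 4 * Δ * F :=
    abs_rankSum_sub_le hk0 (fun r hr => (hG r hr).1) w hw
  have hVle : (V : ℝ) ≤ 8 * k * (m : ℝ) ^ (1 - 1 / k) * (Δ * F) ^ 2 :=
    length_mul_rankSum_sq_le (by linarith) (fun r hr => (hG r hr).2) w hw
  -- It remains to choose a tolerance τ that passes Chebyshev's test and is small enough for the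
  -- answer. The `- 1` in `medianAnswer` makes the actual denominator equal to `Δ * a`.
  have hprob : ∀ τ : ℝ, 0 < τ → 15 * ((a * V : ℕ) : ℝ) ≤ τ ^ 2 →
      (∀ y : ℕ, |(y : ℝ) - a * M| ≤ τ → |(y : ℝ) / (Δ * a) - F| ≤ ε * F) →
      ENNReal.ofReal (1 - δ) ≤
      ((listPow (copyLaw timeRange timeUpdate p stream (PMF.pure [])) (copyCount K sz p)).map
        fun ss => ((medianAnswer pw K sz p ss).1 : ℝ) /
          ((medianAnswer pw K sz p ss).2 + 1)).toOuterMeasure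
        {y | |y - F| ≤ ε * F} :=
    fun τ hτ hτV hgood => by
    have h1 := median_concentration (copyLaw timeRange timeUpdate p stream (PMF.pure []))
      (estimate pw p) M V a (groupCount p) hτ hE hV hτV
    have h2 : ENNReal.ofReal (1 - δ) ≤ 1 - (2 ^ groupCount p)⁻¹ := by
      obtain ⟨hb, -⟩ := groupCount_bounds hδ0 hδ1 p (by rw [hp])
      rw [ENNReal.ofReal_sub _ hδ0.le, ENNReal.ofReal_one]
      refine tsub_le_tsub_left ?_ 1
      have e : ((2 : ℝ≥0∞) ^ groupCount p)⁻¹ = ENNReal.ofReal (((2 : ℝ) ^ groupCount p)⁻¹) := by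
        rw [ENNReal.ofReal_inv_of_pos (by positivity), ENNReal.ofReal_pow (by norm_num)]
        norm_num
      rw [e]
      exact ENNReal.ofReal_le_ofReal hb
    refine (h2.trans h1).trans ?_
    rw [PMF.toOuterMeasure_map_apply]
    refine (listPow _ _).toOuterMeasure.mono fun ss hss => ?_
    have h3 := hgood _ hss
    have e : (((medianAnswer pw K sz p ss).2 : ℕ) : ℝ) + 1 = Δ * a := by
      have h4 : (8 * p.2.2.1 + 1) * a - 1 + 1 = (8 * p.2.2.1 + 1) * a :=
        Nat.sub_add_cancel (Nat.mul_pos (Nat.succ_pos _) ha0)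
      have h5 : (medianAnswer pw K sz p ss).2 + 1 = (8 * p.2.2.1 + 1) * a := h4
      rw [hΔ_def]
      exact_mod_cast h5
    change |((medianAnswer pw K sz p ss).1 : ℝ) / ((medianAnswer pw K sz p ss).2 + 1) - F| ≤ ε * F
    rw [e]
    exact h3
  have hscale : ∀ y : ℝ, y / (Δ * a) - F = (y - a * (Δ * F)) / (Δ * a) := fun y => by
    field_simp
  rcases eq_or_lt_of_le hF0 with hF | hF
  · rw [← hF] at hVle hM
    have hV0 : V = 0 := by
      have : (V : ℝ) ≤ 0 := by simpa using hVle
      exact_mod_cast le_antisymm this (Nat.cast_nonneg _)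
    have hM0 : (M : ℝ) = 0 := by simpa using hM
    -- For `F = 0` the relative tolerance would be 0. As mean and second moment vanish, any positive
    -- τ is allowed, and an integer within 1/2 of 0 is 0.
    refine hprob (1 / 2) (by norm_num) (by rw [hV0]; norm_num) fun y hy => ?_
    have hy0 : y = 0 := by
      rw [hM0, mul_zero, sub_zero, Nat.abs_cast] at hy
      by_contra hne
      have : (1 : ℝ) ≤ y := by exact_mod_cast Nat.one_le_iff_ne_zero.2 hne
      linarith
    rw [hy0, ← hF]
    simp
  -- Sampling and rounding each use a quarter of ε. Chebyshev's test then needs `15 * 8 * 16 * k =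
  -- 1920 k` times `m^(1-1/k)` to be at most `ε² a`.
  · refine hprob (ε / 4 * a * (Δ * F)) (by positivity) ?_ fun y hy => ?_
    · push_cast
      have h1 : 15 * ((a : ℝ) * V) ≤ 15 * (a * (8 * k * (m : ℝ) ^ (1 - 1 / k) * (Δ * F) ^ 2)) := by
        gcongr
      refine h1.trans ?_
      have h2 := mul_le_mul_of_nonneg_right ha_lower
        (show 0 ≤ (a : ℝ) * (Δ * F) ^ 2 / 16 by positivity)
      calc 15 * (a * (8 * k * (m : ℝ) ^ (1 - 1 / k) * (Δ * F) ^ 2))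
          = 1920 * k * (m : ℝ) ^ (1 - 1 / k) * (a * (Δ * F) ^ 2 / 16) := by ring
        _ ≤ ε ^ 2 * a * (a * (Δ * F) ^ 2 / 16) := h2
        _ = _ := by ring
    · rw [hscale, abs_div, abs_of_pos (show 0 < Δ * a by positivity),
        div_le_iff₀ (by positivity)]
      have h1 : |(a : ℝ) * M - a * (Δ * F)| ≤ a * (ε / 4 * Δ * F) := by
        rw [← mul_sub, abs_mul, abs_of_pos haR]
        exact mul_le_mul_of_nonneg_left hM haR.le
      have h2 := abs_sub_le (y : ℝ) (a * M) (a * (Δ * F))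
      have h3 : 0 ≤ ε * a * (Δ * F) := by positivity
      nlinarith

end parameters

end WindowSketch

/-! ### Assembly of the two models. -/

open WindowSketch in
theorem mainTheorem9 (k : ℝ) (hk : 2 < k) :
    -- sequence-based windows
    (∃ A : StreamAlgorithm ℕ, (IsComputableReal k → A.Effective) ∧
      ∃ (C : ℝ) (c : ℕ), ∀ (m n : ℕ) (ε δ : ℝ), 1 ≤ m → 1 ≤ n → 0 < ε → ε < 1 → 0 < δ → δ < 1 →
        ∀ stream : List ℕ, (∀ x ∈ stream, 1 ≤ x ∧ x ≤ m) →
          A.MemoryAtMost (m, n, ⌈1 / ε⌉₊, ⌈1 / δ⌉₊) stream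
            (C * (1 / ε ^ 2) * Real.log (2 / δ) * (m : ℝ) ^ (1 - 1 / k) *
              Real.log (2 + m * n) ^ c) ∧
          A.Approximates (m, n, ⌈1 / ε⌉₊, ⌈1 / δ⌉₊) stream ε δ
            (freqMoment k m (seqWindow n stream))) ∧
    -- timestamp-based windows
    (∃ A : StreamAlgorithm (Option ℕ), (IsComputableReal k → A.Effective) ∧
      ∃ (C : ℝ) (c : ℕ), ∀ (m t₀ : ℕ) (ε δ : ℝ), 1 ≤ m → 1 ≤ t₀ → 0 < ε → ε < 1 → 0 < δ → δ < 1 →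
        ∀ stream : List (Option ℕ), (∀ x : ℕ, some x ∈ stream → 1 ≤ x ∧ x ≤ m) →
          A.MemoryAtMost (m, t₀, ⌈1 / ε⌉₊, ⌈1 / δ⌉₊) stream
            (C * (1 / ε ^ 2) * Real.log (2 / δ) * (m : ℝ) ^ (1 - 1 / k) *
              Real.log (2 + m * t₀ * (timeWindow t₀ stream).length) ^ c) ∧
          A.Approximates (m, t₀, ⌈1 / ε⌉₊, ⌈1 / δ⌉₊) stream ε δ
            (freqMoment k m (timeWindow t₀ stream))) := by

  obtain ⟨pw, hpwc, hpw⟩ := exists_power_approx hk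
  obtain ⟨sz, hszc, hsz⟩ := exists_size_approx hk hpw
  set K := ⌈1920 * k⌉₊
  have hK : 1920 * k ≤ K := Nat.le_ceil _
  refine ⟨⟨copiesAlgorithm seqRange seqUpdate (copyCount K sz) (medianAnswer pw K sz), fun hc => ?_,
    90720 * K * 4, 2, fun m n ε δ hm hn hε0 hε1 hδ0 hδ1 stream hs => ?_⟩,
    ⟨copiesAlgorithm timeRange timeUpdate (copyCount K sz) (medianAnswer pw K sz), fun hc => ?_,
    90720 * K, 2, fun m t₀ ε δ hm ht hε0 hε1 hδ0 hδ1 stream hs => ⟨fun s hmem => ?_, ?_⟩⟩⟩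
  · exact effective_copiesAlgorithm primrec_seqRange primrec_seqUpdate
      (computable_copyCount K (hszc (hpwc hc)))
      (computable_medianAnswer K (hpwc hc) (hszc (hpwc hc)))
  · have hs' : ∀ x : ℕ, some x ∈ timed stream → 1 ≤ x ∧ x ≤ m := fun x hx => by
      refine hs x ?_
      simpa [timed] using hx
    refine ⟨fun s hmem => ?_, ?_⟩
    · rw [stateLaw_copiesAlgorithm, copyLaw_seq] at hmem
      obtain ⟨ss, hss, rfl⟩ := (PMF.mem_support_map_iff _ _ _).1 hmem
      refine (length_encodeState_le_of_mem_support (fun m hm => (hsz m hm).2) hm hn hε0 hε1 hδ0 hδ1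
        hs' rfl hss).trans ?_
      have hlen : ((timeWindow n (timed stream)).length : ℝ) ≤ n := by
        rw [timeWindow_timed, seqWindow, List.length_drop]
        exact_mod_cast (by omega : stream.length - (stream.length - n) ≤ n)
      have hm1 : (1 : ℝ) ≤ m := by exact_mod_cast hm
      -- The window has at most n elements, so the logarithm at most doubles; its square accounts
      -- for the factor 4 in the constant.
      have h1 : (2 : ℝ) + m * n * (timeWindow n (timed stream)).length ≤ (2 + m * n) ^ 2 := by
        have h2 : (m : ℝ) * n * (timeWindow n (timed stream)).length ≤ m * n * n := by gcongr
        have h3 : (m : ℝ) * n * n ≤ m * n * (m * n) := by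
          gcongr
          exact le_mul_of_one_le_left (Nat.cast_nonneg _) hm1
        have h4 : (0 : ℝ) ≤ m * n := by positivity
        nlinarith
      have h2 := Real.log_le_log (by positivity) h1
      rw [Real.log_pow] at h2
      have h3 : 0 ≤ Real.log (2 + m * n * (timeWindow n (timed stream)).length) :=
        Real.log_nonneg (by
          have : (0 : ℝ) ≤ m * n * (timeWindow n (timed stream)).length := by positivity
          linarith)
      have h4 : Real.log (2 + m * n * (timeWindow n (timed stream)).length) ^ 2 ≤
          4 * Real.log (2 + m * n) ^ 2 := by
        refine (pow_le_pow_left₀ h3 h2 2).trans (le_of_eq ?_)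
        push_cast
        ring
      have hlog : 0 ≤ Real.log (2 / δ) := Real.log_nonneg (by rw [le_div_iff₀ hδ0]; linarith)
      calc 90720 * (K : ℝ) * (1 / ε ^ 2) * Real.log (2 / δ) * (m : ℝ) ^ (1 - 1 / k) *
            Real.log (2 + m * n * (timeWindow n (timed stream)).length) ^ 2
          ≤ 90720 * (K : ℝ) * (1 / ε ^ 2) * Real.log (2 / δ) * (m : ℝ) ^ (1 - 1 / k) *
            (4 * Real.log (2 + m * n) ^ 2) := by gcongr
        _ = _ := by ring
    · rw [StreamAlgorithm.Approximates, answerLaw_copiesAlgorithm, copyLaw_seq, ← timeWindow_timed]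
      exact le_toOuterMeasure_medianAnswer hk hK hpw (fun m hm => (hsz m hm).1) hm hn hε0 hε1 hδ0
        hδ1 hs' rfl
  · exact effective_copiesAlgorithm primrec_timeRange primrec_timeUpdate
      (computable_copyCount K (hszc (hpwc hc)))
      (computable_medianAnswer K (hpwc hc) (hszc (hpwc hc)))
  · rw [stateLaw_copiesAlgorithm] at hmem
    obtain ⟨ss, hss, rfl⟩ := (PMF.mem_support_map_iff _ _ _).1 hmem
    exact length_encodeState_le_of_mem_support (fun m hm => (hsz m hm).2) hm ht hε0 hε1 hδ0 hδ1
      hs rfl hss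
  · rw [StreamAlgorithm.Approximates, answerLaw_copiesAlgorithm]
    exact le_toOuterMeasure_medianAnswer hk hK hpw (fun m hm => (hsz m hm).1) hm ht hε0 hε1 hδ0
      hδ1 hs rfl
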